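/- Let $\mathbb K=\mathbb R$ or $\mathbb C$ and $R=\mathbb K[x,y]$. For a finite connected directed graph $G=(V,E)$ (the edge $e$ running from $\mathrm{tail}(e)$ to $\mathrm{head}(e)$) and an edge-labeling $\ell\colon E\to R$, a *spline* on $(G,\ell)$ is a map $p\colon V\to R$ such that $\ell(e)$ divides $p(\mathrm{head}(e))-p(\mathrm{tail}(e))$ for each edge $e$. Let $\mathsf{Spl}_{\le d}(G,\ell)$ be the $\mathbb K$-vector space of splines all of whose values have degree at most $d$. For $v_0\in V$ let $\mathsf{Spl}_{\le d}(G,\ell;v_0)$ be the subspace $\{p(v_0)=0\}$, a complement of the constant splines. Let $\mathsf{Spl}_2(G,\ell;v_0)$ be the space of splines that vanish at $v_0$ and all of whose values are zero or homogeneous of degree $2$. If no label is zero, let $\varphi_\ell(p)\in R^E$ be given by $p(\mathrm{head}(e))-p(\mathrm{tail}(e))=\varphi_\ell(p)(e)\,\ell(e)$. Let $G$ be embedded in the plane. A labeling $\ell'$ is *face-translatable* if for the cycle around each bounded face there is a point $(x_0,y_0)\in\mathbb K^2$ at which all labels on that cycle vanish. **Theorem.** Let $G$ be a finite connected directed plane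 graph and $\ell'(e)=(a_ex+b_ey+c_e)^2$, with $(a_e,b_e)\ne(0,0)$ for each edge $e$, a face-translatable labeling with homogenization $\ell(e)=(a_ex+b_ey)^2$. 1. $\varphi_{\ell'}$ maps $\mathsf{Spl}_{\le2}(G,\ell')$ onto $\ker M^{\mathsf{ext}}\subseteq\mathbb K^E$. Here $M^{\mathsf{ext}}$ has, for each bounded face $F$, three rows with entries $\varepsilon_{F,e}a_e^2,\ \varepsilon_{F,e}a_eb_e,\ \varepsilon_{F,e}b_e^2$ in column $e$, where $\varepsilon_{F,e}$ is $1$ or $-1$ if $e$ lies on the cycle around $F$ and points clockwise, respectively counterclockwise, and $0$ if $e$ is not on that cycle. 2. For each vertex $v_0$ there is an isomorphism of vector spaces $\Psi\colon\mathsf{Spl}_{\le2}(G,\ell';v_0)\to\mathsf{Spl}_2(G,\ell;v_0)$ with $\varphi_\ell\circ\Psi=\varphi_{\ell'}$, and $\mathsf{Spl}_{\le2}(G,\ell;v_0)=\mathsf{Spl}_2(G,\ell;v_0)$. Moreover $\mathsf{Spl}_{\le2}(G,\ell')\cong\mathsf{Spl}_{\le2}(G,\ell)$ as vector spaces. 3.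 There are $x_0,y_0\in\mathbb K$ such that $\tau\colon x\mapsto x_0x-y_0y,\ y\mapsto y_0x+x_0y$ defines an automorphism of the $\mathbb K$-algebra $R$, and scalars $u_e\ne0$, $m_e$, $s_e$ with $\tau(\ell'(e))=u_e(x+m_ey+s_e)^2$ and $\tau(\ell(e))=u_e(x+m_ey)^2$ for each $e$. The labeling $e\mapsto(x+m_ey+s_e)^2$ is again face-translatable, and for each $d$, $p\mapsto\tau\circ p$ identifies $\mathsf{Spl}_{\le d}(G,\ell')$ and $\mathsf{Spl}_{\le d}(G,\ell)$ with the spaces of splines of degree at most $d$ for the labelings $(x+m_ey+s_e)^2$ and $(x+m_ey)^2$, respectively. In particular, let $\Delta$ be a planar triangulation: a finite non-empty simplicial complex in $\mathbb R^2$ in which each simplex is a face of a triangle, any two triangles are joined by a chain of triangles in which consecutive ones share an edge, and the region covered has connected complement (no holes). Let $G_\Delta$ be its dual graph, with one vertex for each triangle and one edge (directed arbitrarily) for each pair of triangles sharing an edge, and label each edge by $\ell'(e)=(a_ex+b_ey+c_e)^2$, where $(a_e,b_e)\neq(0,0)$ and the shared edge lies on the line $a_ex+b_ey+c_e=0$;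 let $\ell(e)=(a_ex+b_ey)^2$. Then the conclusions of part 2 hold for $(G_\Delta,\ell')$ and $(G_\Delta,\ell)$. -/

import Mathlib

open MvPolynomial

/-- A directed graph (loops and parallel edges allowed) with vertex set `V` and edge set `E`. -/
structure DirGraph (V E : Type*) where
  tail : E → V
  head : E → V

namespace DirGraph

variable {V E : Type*} (G : DirGraph V E)

/-- Connectedness of the underlying undirected graph. -/
def IsConnected : Prop :=
  Nonempty V ∧ ∀ u v : V, Relation.EqvGen (fun u v => ∃ e, G.tail e = u ∧ G.head e = v) u v

/-- Every edge `e` carries two darts (half-edges): `(e, true)` runs from the tail of `e` to its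
head, and `(e, false)` runs from the head of `e` to its tail. `G.src d` is the start of `d`. -/
def src (d : E × Bool) : V := if d.2 then G.tail d.1 else G.head d.1

end DirGraph

/-- The same edge, traversed in the opposite direction. -/
def dartRev {E : Type*} : Equiv.Perm (E × Bool) where
  toFun d := (d.1, !d.2)
  invFun d := (d.1, !d.2)
  left_inv d := by simp
  right_inv d := by simp

/-- A finite connected directed graph drawn in the plane without crossings, described by its
combinatorial embedding (rotation system): `rot` sends every dart to the next one,
counterclockwise, among the darts starting at the same vertex. Walking along a dart `d` and then
leaving along the dart that follows `dartRev d` in the rotation traces the boundaries of the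
regions of the drawing, each with the region on the right-hand side; so a face is an orbit of
`d ↦ rot (dartRev d)`, and bounded faces are traversed clockwise. One face is the unbounded one
(if there is no edge, there is one vertex and no boundary walk, and `outer` is empty). The surface
on which the drawing lives is the sphere, that is, Euler's formula
`#V - #E + #(bounded faces) + 1 = 2` holds. -/
structure PlaneGraph (V E : Type*) [Fintype V] [Fintype E] extends DirGraph V E where
  connected : toDirGraph.IsConnected
  rot : Equiv.Perm (E × Bool)
  rot_sameCycle_iff : ∀ d d', rot.SameCycle d d' ↔ toDirGraph.src d = toDirGraph.src d'
  outer : Set (Quotient (Equiv.Perm.SameCycle.setoid (rot * dartRev)))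
  exists_outer : Nonempty E → ∃ F, outer = {F}
  euler : Nat.card V + Nat.card {F // F ∉ outer} = Nat.card E + 1

namespace PlaneGraph

variable {V E : Type*} [Fintype V] [Fintype E] (G : PlaneGraph V E)

/-- The bounded faces. -/
abbrev BoundedFace : Type _ := {F // F ∉ G.outer}

/-- The boundary walk of `F` passes through the dart `d`. -/
def HasDart (F : G.BoundedFace) (d : E × Bool) : Prop :=
  (Quotient.mk (Equiv.Perm.SameCycle.setoid (G.rot * dartRev)) d) = F.1

open Classical in
/-- The cycle basis matrix: the entry at `(F, e)` is `1` or `-1` if `e` is an edge of the face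
cycle of `F` that points clockwise, respectively counterclockwise, around `F`, and `0` if `e` is not
on it. (An edge with `F` on both of its sides is a bridge, and belongs to no cycle.) -/
noncomputable def cycleMatrix (F : G.BoundedFace) (e : E) : ℤ :=
  (if G.HasDart F (e, true) then 1 else 0) - (if G.HasDart F (e, false) then 1 else 0)

/-- The edge `e` lies on the face cycle of `F`. -/
def OnFaceCycle (F : G.BoundedFace) (e : E) : Prop :=
  Xor (G.HasDart F (e, true)) (G.HasDart F (e, false))

/-- An edge-labeling is face-translatable if, for the cycle around each bounded face, some point
of the plane is a zero of all labels on that cycle. -/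
def FaceTranslatable {𝕜 : Type*} [Field 𝕜] (l : E → MvPolynomial (Fin 2) 𝕜) : Prop :=
  ∀ F : G.BoundedFace, ∃ x₀ y₀ : 𝕜, ∀ e, G.OnFaceCycle F e → eval ![x₀, y₀] (l e) = 0

/-- The extended cycle basis matrix for edge labels `(a x + b y + c)²`: the row of each bounded
face is replaced by three rows, weighted by `a²`, `a b`, `b²`. For `a = 1` the weights are
`1`, `b`, `b²`. -/
noncomputable def extMatrix {𝕜 : Type*} [Field 𝕜] (a b : E → 𝕜) :
    Matrix (G.BoundedFace × Fin 3) E 𝕜 :=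
  fun r e => (G.cycleMatrix r.1 e : 𝕜) * ![a e ^ 2, a e * b e, b e ^ 2] r.2

end PlaneGraph

/-- The polynomial `(a x + b y + c)²`. -/
noncomputable def affineSq {𝕜 : Type*} [Field 𝕜] (a b c : 𝕜) : MvPolynomial (Fin 2) 𝕜 :=
  (C a * X 0 + C b * X 1 + C c) ^ 2

namespace DirGraph

variable {V E : Type*} (G : DirGraph V E) {𝕜 : Type*} [Field 𝕜]
  (l : E → MvPolynomial (Fin 2) 𝕜)

/-- Splines on the edge-labeled graph `(G, l)`. -/
noncomputable def spl : Submodule 𝕜 (V → MvPolynomial (Fin 2) 𝕜) where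
  carrier := {p | ∀ e, l e ∣ p (G.head e) - p (G.tail e)}
  zero_mem' e := by simp
  add_mem' {p q} hp hq e := by
    have := dvd_add (hp e) (hq e)
    simpa [add_sub_add_comm] using this
  smul_mem' r p hp e := by
    have := (hp e).mul_left (C r)
    simpa [MvPolynomial.smul_eq_C_mul, mul_sub] using this

/-- Splines of degree at most `d`. -/
noncomputable def splLE (d : ℕ) : Submodule 𝕜 (V → MvPolynomial (Fin 2) 𝕜) :=
  G.spl l ⊓ Submodule.pi Set.univ fun _ => restrictTotalDegree (Fin 2) 𝕜 d

/-- Splines of degree at most `d` vanishing at the vertex `v₀`. -/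
noncomputable def splLEAt (d : ℕ) (v₀ : V) : Submodule 𝕜 (V → MvPolynomial (Fin 2) 𝕜) :=
  G.splLE l d ⊓ LinearMap.ker (LinearMap.proj v₀)

/-- Homogeneous splines of degree `d` (each value is zero or homogeneous of degree `d`) vanishing
at the vertex `v₀`. -/
noncomputable def splHomAt (d : ℕ) (v₀ : V) : Submodule 𝕜 (V → MvPolynomial (Fin 2) 𝕜) :=
  G.spl l ⊓ (Submodule.pi Set.univ fun _ => homogeneousSubmodule (Fin 2) 𝕜 d) ⊓
    LinearMap.ker (LinearMap.proj v₀)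

open Classical in
/-- The map sending a spline `p` to the family of polynomials `c e` on the edges with
`p (head e) - p (tail e) = c e * l e`. They are unique if no label is zero; the value is `0` where
no such polynomial exists, which does not happen for a spline. -/
noncomputable def cofactor (p : V → MvPolynomial (Fin 2) 𝕜) (e : E) : MvPolynomial (Fin 2) 𝕜 :=
  if h : l e ∣ p (G.head e) - p (G.tail e) then h.choose else 0

end DirGraph

/-- A planar triangulation: a finite simplicial complex in the plane in which each simplex is a
face of a triangle, that is connected through its edges (any two triangles are joined by a
sequence of triangles in which consecutive ones share an edge), and whose underlying region has no
holes. -/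
structure PlanarTriangulation where
  complex : Geometry.SimplicialComplex ℝ (ℝ × ℝ)
  finite : complex.faces.Finite
  pure : ∀ s ∈ complex.faces, ∃ t ∈ complex.faces, s ⊆ t ∧ t.card = 3
  nonempty : complex.faces.Nonempty
  edge_connected : ∀ t t' : {t // t ∈ complex.faces ∧ t.card = 3},
    Relation.ReflTransGen (fun t t' : {t // t ∈ complex.faces ∧ t.card = 3} =>
      ∃ e ∈ complex.faces, e.card = 2 ∧ e ⊆ t.1 ∧ e ⊆ t'.1) t t'
  no_holes : IsConnected (complex.spaceᶜ)

namespace PlanarTriangulation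

variable (Δ : PlanarTriangulation)

/-- The triangles of the triangulation. -/
abbrev Triangle : Type := {t // t ∈ Δ.complex.faces ∧ t.card = 3}

/-- The dual graph: one vertex for each triangle, and an edge between two distinct triangles that
share an edge of the triangulation. -/
def dualGraph : SimpleGraph Δ.Triangle where
  Adj t t' := t ≠ t' ∧ ∃ e ∈ Δ.complex.faces, e.card = 2 ∧ e ⊆ t.1 ∧ e ⊆ t'.1
  symm := ⟨fun _ _ ⟨h, e, he, h2, h3, h4⟩ => ⟨h.symm, e, he, h2, h4, h3⟩⟩
  loopless := ⟨fun _ h => h.1 rfl⟩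

/-- `G` is the dual graph, with some choice of a direction for each edge. -/
def IsDirectedDual (G : DirGraph Δ.Triangle Δ.dualGraph.edgeSet) : Prop :=
  ∀ e, s(G.tail e, G.head e) = e.1

end PlanarTriangulation

/-! Values of degree at most two and labels of degree two force constant cofactors `z e`. Up to its
value at one vertex, a spline is therefore a vector `z` for which the edge function `z e * ℓ'(e)` is
a difference of vertex values. The theorem says that the same vectors `z` occur for `ℓ'` and for
`ℓ`; the isomorphism takes the homogeneous part of degree two (`topPart_bijective`).

For a plane graph the face cycles span the cycle space (`exists_of_sum_cycleMatrix_eq_zero`: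
independence plus Euler's formula), so `z` is admissible exactly when the signed sum of `z e *
ℓ'(e)` around each bounded face vanishes. The labels of one face have a common zero, and translating
the origin to it turns all the `ℓ(e)` of that face into the `ℓ'(e)` at once. So the conditions for
`ℓ'` and `ℓ` agree face by face, and the coefficients of `x²`, `xy`, `y²` in the latter are the rows
of `extMatrix`. The normal form comes from a similarity avoiding finitely many bad directions.

For a triangulation no rotation system is constructed. Given a spline `q` for `ℓ`, let `T v` be the
translation to the vertex `v`. Around `v`, the polynomials `T v (q t)` already solve the problem for
`ℓ'`. The discrepancies `T w (q t) - T v (q t)` form a closed 1-cochain on the complex. It is exact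
because there are no holes (`exists_vertex_potential`), and a potential `r` glues the local
solutions to `T v (q t) - r v`. Exactness rests on winding numbers: every 1-cycle is the boundary of
the 2-chain of its winding numbers around the triangles (`cycle_eq_boundary`). -/

/-! ### Potentials on finite graphs -/

/-- A function on the edges of a finite directed graph is a difference of vertex values if it is
annihilated by all cycles. -/
theorem exists_potential {k V E W : Type*} [Field k] [Finite V] [Fintype E] [AddCommGroup W]
    [Module k W] (tail head : E → V) (z : E → W)
    (h : ∀ c : E → k, (∀ f : V → k, ∑ e, c e * (f (head e) - f (tail e)) = 0) →
      ∑ e, c e • z e = 0) :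
    ∃ p : V → W, ∀ e, p (head e) - p (tail e) = z e := by
  classical
  let D : (V → k) →ₗ[k] (E → k) :=
    { toFun := fun f e => f (head e) - f (tail e)
      map_add' := fun f g => by ext e; simp [add_sub_add_comm]
      map_smul' := fun r f => by ext e; simp [mul_sub] }
  -- `s` is a linear section of the coboundary `D` on its range, extended to all edge functions;
  -- thus `D ∘ s ∘ D = D`.
  obtain ⟨s₀, hs₀⟩ := D.rangeRestrict.exists_rightInverse_of_surjective D.range_rangeRestrict
  obtain ⟨s, hs⟩ := LinearMap.exists_extend s₀
  have hsD : ∀ f, D (s (D f)) = D f := fun f => by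
    have h1 : s (D f) = s₀ (D.rangeRestrict f) := by
      rw [← hs]; rfl
    have h2 := LinearMap.congr_fun hs₀ (D.rangeRestrict f)
    rw [h1]
    simpa using congrArg Subtype.val h2
  have hsum : ∀ y : E → k, y = ∑ e, y e • (Pi.single e 1 : E → k) := fun y => by
    ext e
    simp [Finset.sum_apply, Pi.single_apply]
  refine ⟨fun v => ∑ e, s (Pi.single e 1) v • z e, fun e₀ => ?_⟩
  -- Row `e₀` of `1 - D ∘ s` annihilates the range of `D`, so it is a cycle to which `h` applies.
  have key := h (fun e => (Pi.single e 1 : E → k) e₀ - D (s (Pi.single e 1)) e₀) fun f => by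
    have h1 : ∀ e, D f e = f (head e) - f (tail e) := fun e => rfl
    have h2 : D f e₀ = ∑ e, D f e * (Pi.single e 1 : E → k) e₀ := by
      simp [Pi.single_apply]
    have h3 : D (s (D f)) e₀ = ∑ e, D f e * D (s (Pi.single e 1)) e₀ := by
      conv_lhs => rw [hsum (D f)]
      simp [map_sum, Finset.sum_apply]
    simp_rw [← h1, sub_mul, Finset.sum_sub_distrib]
    rw [sub_eq_zero]
    simp_rw [mul_comm _ (D f _)]
    rw [← h2, ← h3, hsD]
  simp_rw [sub_smul, Finset.sum_sub_distrib] at key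
  rw [sub_eq_zero] at key
  rw [← Finset.sum_sub_distrib]
  simp_rw [← sub_smul]
  have h4 : ∑ e, (Pi.single e 1 : E → k) e₀ • z e = z e₀ := by
    simp [Pi.single_apply]
  rw [← h4, key]
  rfl

/-! ### Squares of affine linear forms -/

section affineSq

variable {𝕜 : Type*} [Field 𝕜] (a b c : 𝕜)

theorem affineSq_zero_isHomogeneous : (affineSq a b 0).IsHomogeneous 2 := by
  have h : (C a * X 0 + C b * X 1 : MvPolynomial (Fin 2) 𝕜).IsHomogeneous 1 :=
    (isHomogeneous_C_mul_X a 0).add (isHomogeneous_C_mul_X b 1)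
  simpa [affineSq] using h.pow 2

theorem affineSq_eq_add : affineSq a b c =
    affineSq a b 0 + C (2 * c) * (C a * X 0 + C b * X 1) + C (c ^ 2) := by
  simp only [affineSq, map_mul, map_pow, map_ofNat, map_zero]
  ring

theorem homogeneousComponent_affineSq :
    homogeneousComponent 2 (affineSq a b c) = affineSq a b 0 := by
  have h : (C a * X 0 + C b * X 1 : MvPolynomial (Fin 2) 𝕜).IsHomogeneous 1 :=
    (isHomogeneous_C_mul_X a 0).add (isHomogeneous_C_mul_X b 1)
  rw [affineSq_eq_add, map_add, map_add, homogeneousComponent_C_mul,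
    homogeneousComponent_eq_self (affineSq_zero_isHomogeneous a b),
    homogeneousComponent_of_mem h, homogeneousComponent_of_mem (isHomogeneous_C _ (c ^ 2))]
  simp

theorem totalDegree_affineSq_le : (affineSq a b c).totalDegree ≤ 2 := by
  have h : (C a * X 0 + C b * X 1 : MvPolynomial (Fin 2) 𝕜).IsHomogeneous 1 :=
    (isHomogeneous_C_mul_X a 0).add (isHomogeneous_C_mul_X b 1)
  have h1 : (C a * X 0 + C b * X 1 + C c : MvPolynomial (Fin 2) 𝕜).totalDegree ≤ 1 :=
    (totalDegree_add _ _).trans (max_le h.totalDegree_le (by simp))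
  exact (totalDegree_pow _ 2).trans (by lia)

variable {a b}

theorem affineSq_zero_ne_zero (h : a ≠ 0 ∨ b ≠ 0) : affineSq a b 0 ≠ 0 := by
  intro h0
  rcases h with h | h
  · simpa [affineSq, h] using congrArg (eval ![1, 0]) h0
  · simpa [affineSq, h] using congrArg (eval ![0, 1]) h0

theorem affineSq_ne_zero (h : a ≠ 0 ∨ b ≠ 0) : affineSq a b c ≠ 0 := fun h0 =>
  affineSq_zero_ne_zero h (by rw [← homogeneousComponent_affineSq a b c, h0, map_zero])

theorem totalDegree_affineSq (h : a ≠ 0 ∨ b ≠ 0) : (affineSq a b c).totalDegree = 2 := by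
  refine le_antisymm (totalDegree_affineSq_le a b c) ?_
  by_contra hlt
  refine affineSq_zero_ne_zero h ?_
  rw [← homogeneousComponent_affineSq a b c, homogeneousComponent_eq_zero]
  lia

/-- A multiple of degree at most two of `(a x + b y + c)²` is a constant multiple. -/
theorem eq_C_mul_affineSq (h : a ≠ 0 ∨ b ≠ 0) {f : MvPolynomial (Fin 2) 𝕜}
    (hf : f.totalDegree ≤ 2) (hdvd : affineSq a b c ∣ f) : ∃ z, f = C z * affineSq a b c := by
  obtain ⟨k, rfl⟩ := hdvd
  by_cases hk : k = 0
  · exact ⟨0, by simp [hk]⟩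
  rw [totalDegree_mul_of_isDomain (affineSq_ne_zero c h) hk, totalDegree_affineSq c h] at hf
  have : k.totalDegree = 0 := by lia
  rw [totalDegree_eq_zero_iff_eq_C] at this
  exact ⟨coeff 0 k, by rw [← this, mul_comm]⟩

end affineSq

/-! ### Splines of degree at most two on a connected graph -/

namespace DirGraph

variable {V E : Type*} {G : DirGraph V E}

/-- Transfers a property from edge differences to vertex differences; `S` will be zero, the
polynomials of bounded degree, or the homogeneous ones. -/
theorem IsConnected.sub_mem {W : Type*} [AddCommGroup W] (hG : G.IsConnected) (S : AddSubgroup W)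
    {p : V → W} (hp : ∀ e, p (G.head e) - p (G.tail e) ∈ S) (u v : V) : p v - p u ∈ S := by
  induction hG.2 u v with
  | rel u v h =>
    obtain ⟨e, rfl, rfl⟩ := h
    exact hp e
  | refl u => simp
  | symm u v _ ih => simpa using S.neg_mem ih
  | trans u v w _ _ ih₁ ih₂ => simpa using S.add_mem ih₂ ih₁

theorem IsConnected.eq_of_diff_eq {W : Type*} [AddCommGroup W] (hG : G.IsConnected)
    {p q : V → W} {v₀ : V} (h₀ : p v₀ = q v₀)
    (h : ∀ e, p (G.head e) - p (G.tail e) = q (G.head e) - q (G.tail e)) : p = q := by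
  funext v
  have := hG.sub_mem ⊥ (p := p - q) (fun e => by
    simp [sub_sub_sub_comm, h e]) v₀ v
  rw [AddSubgroup.mem_bot, Pi.sub_apply, Pi.sub_apply, h₀, sub_self, sub_zero] at this
  exact sub_eq_zero.1 this

variable {𝕜 : Type*} [Field 𝕜]

theorem cofactor_eq {l : E → MvPolynomial (Fin 2) 𝕜} {p : V → MvPolynomial (Fin 2) 𝕜} {e : E}
    {k : MvPolynomial (Fin 2) 𝕜} (hl : l e ≠ 0) (h : p (G.head e) - p (G.tail e) = k * l e) :
    G.cofactor l p e = k := by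
  have hd : l e ∣ p (G.head e) - p (G.tail e) := ⟨k, by rw [h, mul_comm]⟩
  rw [cofactor, dif_pos hd]
  exact mul_left_cancel₀ hl ((hd.choose_spec.symm.trans h).trans (mul_comm _ _))

theorem mem_splLE {l : E → MvPolynomial (Fin 2) 𝕜} {d : ℕ} {p : V → MvPolynomial (Fin 2) 𝕜} :
    p ∈ G.splLE l d ↔
      (∀ e, l e ∣ p (G.head e) - p (G.tail e)) ∧ ∀ v, (p v).totalDegree ≤ d := by
  simp [splLE, spl, Submodule.mem_pi, mem_restrictTotalDegree]

theorem mem_splLEAt {l : E → MvPolynomial (Fin 2) 𝕜} {d : ℕ} {v₀ : V}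
    {p : V → MvPolynomial (Fin 2) 𝕜} :
    p ∈ G.splLEAt l d v₀ ↔ p ∈ G.splLE l d ∧ p v₀ = 0 := by
  simp [splLEAt]

theorem mem_splHomAt {l : E → MvPolynomial (Fin 2) 𝕜} {d : ℕ} {v₀ : V}
    {p : V → MvPolynomial (Fin 2) 𝕜} :
    p ∈ G.splHomAt l d v₀ ↔ (∀ e, l e ∣ p (G.head e) - p (G.tail e)) ∧
      (∀ v, (p v).IsHomogeneous d) ∧ p v₀ = 0 := by
  simp [splHomAt, spl, Submodule.mem_pi, and_assoc]

section labels

variable {a b c : E → 𝕜}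

theorem exists_const_of_mem_splLE (hab : ∀ e, a e ≠ 0 ∨ b e ≠ 0)
    {p : V → MvPolynomial (Fin 2) 𝕜}
    (hp : p ∈ G.splLE (fun e => affineSq (a e) (b e) (c e)) 2) :
    ∃ z : E → 𝕜, ∀ e, p (G.head e) - p (G.tail e) = C (z e) * affineSq (a e) (b e) (c e) := by
  rw [mem_splLE] at hp
  choose z hz using fun e => eq_C_mul_affineSq (c e) (hab e)
    ((totalDegree_sub _ _).trans (max_le (hp.2 (G.head e)) (hp.2 (G.tail e)))) (hp.1 e)
  exact ⟨z, hz⟩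

/-- A solution of the difference equation can be normalized to be a spline vanishing at `v₀`. -/
theorem IsConnected.sub_mem_splLEAt (hG : G.IsConnected) (v₀ : V) {z : E → 𝕜}
    {p : V → MvPolynomial (Fin 2) 𝕜}
    (hp : ∀ e, p (G.head e) - p (G.tail e) = C (z e) * affineSq (a e) (b e) (c e)) :
    (fun v => p v - p v₀) ∈ G.splLEAt (fun e => affineSq (a e) (b e) (c e)) 2 v₀ := by
  refine mem_splLEAt.2 ⟨mem_splLE.2 ⟨fun e => ?_, fun v => ?_⟩, sub_self _⟩
  · simp [hp]
  · have := hG.sub_mem (restrictTotalDegree (Fin 2) 𝕜 2).toAddSubgroup (p := p) (fun e => by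
      rw [hp, Submodule.mem_toAddSubgroup, mem_restrictTotalDegree]
      refine (totalDegree_mul _ _).trans ?_
      simpa using totalDegree_affineSq_le (a e) (b e) (c e)) v₀ v
    rwa [Submodule.mem_toAddSubgroup, mem_restrictTotalDegree] at this

/-- Edge differences are constant multiples of quadratic forms, so every value reached from zero at
`v₀` is a quadratic form. -/
theorem splLEAt_eq_splHomAt (hG : G.IsConnected) (hab : ∀ e, a e ≠ 0 ∨ b e ≠ 0) (v₀ : V) :
    G.splLEAt (fun e => affineSq (a e) (b e) 0) 2 v₀ =
      G.splHomAt (fun e => affineSq (a e) (b e) 0) 2 v₀ := by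
  ext p
  rw [mem_splLEAt, mem_splHomAt]
  constructor
  · rintro ⟨hp, h₀⟩
    obtain ⟨z, hz⟩ := exists_const_of_mem_splLE (c := fun _ => 0) hab hp
    refine ⟨(mem_splLE.1 hp).1, fun v => ?_, h₀⟩
    have := hG.sub_mem (homogeneousSubmodule (Fin 2) 𝕜 2).toAddSubgroup (p := p) (fun e => by
      rw [hz, Submodule.mem_toAddSubgroup, mem_homogeneousSubmodule]
      exact (affineSq_zero_isHomogeneous (a e) (b e)).C_mul _) v₀ v
    rwa [Submodule.mem_toAddSubgroup, mem_homogeneousSubmodule, h₀, sub_zero] at this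
  · rintro ⟨h₁, h₂, h₀⟩
    exact ⟨mem_splLE.2 ⟨h₁, fun v => (h₂ v).totalDegree_le⟩, h₀⟩

theorem homogeneousComponent_mem_splHomAt (hab : ∀ e, a e ≠ 0 ∨ b e ≠ 0) {v₀ : V}
    {p : V → MvPolynomial (Fin 2) 𝕜}
    (hp : p ∈ G.splLEAt (fun e => affineSq (a e) (b e) (c e)) 2 v₀) :
    (fun v => homogeneousComponent 2 (p v)) ∈
      G.splHomAt (fun e => affineSq (a e) (b e) 0) 2 v₀ := by
  rw [mem_splLEAt] at hp
  obtain ⟨z, hz⟩ := exists_const_of_mem_splLE hab hp.1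
  refine mem_splHomAt.2
    ⟨fun e => ?_, fun v => homogeneousComponent_isHomogeneous _ _, by simp [hp.2]⟩
  rw [← map_sub, hz, homogeneousComponent_C_mul, homogeneousComponent_affineSq]
  exact dvd_mul_left _ _

/-- The map taking a spline of degree at most two to its homogeneous part of degree two. -/
noncomputable def topPart (G : DirGraph V E) (hab : ∀ e, a e ≠ 0 ∨ b e ≠ 0) (v₀ : V) :
    G.splLEAt (fun e => affineSq (a e) (b e) (c e)) 2 v₀ →ₗ[𝕜]
      G.splHomAt (fun e => affineSq (a e) (b e) 0) 2 v₀ where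
  toFun p := ⟨fun v => homogeneousComponent 2 (p.1 v), homogeneousComponent_mem_splHomAt hab p.2⟩
  map_add' p q := by ext1; funext v; simp
  map_smul' r p := by ext1; funext v; simp

theorem cofactor_topPart (hab : ∀ e, a e ≠ 0 ∨ b e ≠ 0) (v₀ : V)
    (p : G.splLEAt (fun e => affineSq (a e) (b e) (c e)) 2 v₀) :
    G.cofactor (fun e => affineSq (a e) (b e) 0) (G.topPart hab v₀ p).1 =
      G.cofactor (fun e => affineSq (a e) (b e) (c e)) p.1 := by
  obtain ⟨z, hz⟩ := exists_const_of_mem_splLE hab (mem_splLEAt.1 p.2).1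
  funext e
  rw [cofactor_eq (l := fun e => affineSq (a e) (b e) (c e))
      (affineSq_ne_zero (c e) (hab e)) (hz e),
    cofactor_eq (l := fun e => affineSq (a e) (b e) 0) (k := C (z e))
      (affineSq_zero_ne_zero (hab e))]
  simp only [topPart, LinearMap.coe_mk, AddHom.coe_mk]
  rw [← map_sub, hz, homogeneousComponent_C_mul, homogeneousComponent_affineSq]

/-- The degree-two part still determines the constants `z`, and these determine a spline vanishing
at `v₀`; this gives injectivity. Surjectivity is the lifting property `H`, the only point where the
geometry of the labels enters. -/
theorem topPart_bijective (hG : G.IsConnected) (hab : ∀ e, a e ≠ 0 ∨ b e ≠ 0)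
    (H : ∀ (z : E → 𝕜) (q : V → MvPolynomial (Fin 2) 𝕜),
      (∀ e, q (G.head e) - q (G.tail e) = C (z e) * affineSq (a e) (b e) 0) →
      ∃ p : V → MvPolynomial (Fin 2) 𝕜,
        ∀ e, p (G.head e) - p (G.tail e) = C (z e) * affineSq (a e) (b e) (c e)) (v₀ : V) :
    Function.Bijective (G.topPart (c := c) hab v₀) := by
  constructor
  · rw [← LinearMap.ker_eq_bot, LinearMap.ker_eq_bot']
    intro p hp
    obtain ⟨z, hz⟩ := exists_const_of_mem_splLE hab (mem_splLEAt.1 p.2).1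
    have h0 : ∀ v, homogeneousComponent 2 (p.1 v) = 0 := fun v =>
      congrFun (congrArg Subtype.val hp) v
    ext1
    refine hG.eq_of_diff_eq (v₀ := v₀) (mem_splLEAt.1 p.2).2 fun e => ?_
    have h1 := congrArg (homogeneousComponent 2) (hz e)
    rw [map_sub, h0, h0, homogeneousComponent_C_mul, homogeneousComponent_affineSq, sub_zero,
      eq_comm, mul_eq_zero, or_iff_left (affineSq_zero_ne_zero (hab e))] at h1
    simp [hz e, h1]
  · rintro ⟨q, hq⟩
    have hq' := hq
    rw [← splLEAt_eq_splHomAt hG hab, mem_splLEAt] at hq'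
    obtain ⟨z, hz⟩ := exists_const_of_mem_splLE (c := fun _ => 0) hab hq'.1
    obtain ⟨p, hp⟩ := H z q hz
    refine ⟨⟨_, hG.sub_mem_splLEAt v₀ hp⟩, ?_⟩
    ext1
    refine hG.eq_of_diff_eq (v₀ := v₀) (by simp [topPart, hq'.2]) fun e => ?_
    simp only [topPart, LinearMap.coe_mk, AddHom.coe_mk]
    rw [hz, ← map_sub, sub_sub_sub_cancel_right, hp, homogeneousComponent_C_mul,
      homogeneousComponent_affineSq]

/-- Splines of degree at most `d` are determined by their value at `v₀` and a spline vanishing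
there. -/
noncomputable def splLEEquiv (l : E → MvPolynomial (Fin 2) 𝕜) (d : ℕ) (v₀ : V) :
    G.splLE l d ≃ₗ[𝕜] restrictTotalDegree (Fin 2) 𝕜 d × G.splLEAt l d v₀ where
  toFun p := (⟨p.1 v₀, (mem_restrictTotalDegree _ _ _).2 ((mem_splLE.1 p.2).2 v₀)⟩,
    ⟨fun v => p.1 v - p.1 v₀, mem_splLEAt.2 ⟨mem_splLE.2
      ⟨fun e => by simpa using (mem_splLE.1 p.2).1 e, fun v => (totalDegree_sub _ _).trans
        (max_le ((mem_splLE.1 p.2).2 v) ((mem_splLE.1 p.2).2 v₀))⟩, sub_self _⟩⟩)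
  invFun x := ⟨fun v => x.2.1 v + x.1.1, mem_splLE.2
    ⟨fun e => by simpa using (mem_splLE.1 (mem_splLEAt.1 x.2.2).1).1 e,
      fun v => (totalDegree_add _ _).trans
        (max_le ((mem_splLE.1 (mem_splLEAt.1 x.2.2).1).2 v)
          ((mem_restrictTotalDegree _ _ _).1 x.1.2))⟩⟩
  map_add' p q := by
    ext1
    · rfl
    · ext1
      funext v
      simp [add_sub_add_comm]
  map_smul' r p := by
    ext1
    · rfl
    · ext1
      funext v
      simp [smul_sub]
  left_inv p := by ext1; funext v; simp
  right_inv x := by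
    have h := (mem_splLEAt.1 x.2.2).2
    ext1
    · ext1
      simp [h]
    · ext1
      funext v
      simp [h]

theorem spline_spaces_equiv (hG : G.IsConnected) (hab : ∀ e, a e ≠ 0 ∨ b e ≠ 0)
    (H : ∀ (z : E → 𝕜) (q : V → MvPolynomial (Fin 2) 𝕜),
      (∀ e, q (G.head e) - q (G.tail e) = C (z e) * affineSq (a e) (b e) 0) →
      ∃ p : V → MvPolynomial (Fin 2) 𝕜,
        ∀ e, p (G.head e) - p (G.tail e) = C (z e) * affineSq (a e) (b e) (c e))
    {l' l : E → MvPolynomial (Fin 2) 𝕜}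
    (hl' : ∀ e, l' e = affineSq (a e) (b e) (c e)) (hl : ∀ e, l e = affineSq (a e) (b e) 0) :
    (∀ v₀ : V,
      (∃ Ψ : G.splLEAt l' 2 v₀ ≃ₗ[𝕜] G.splHomAt l 2 v₀,
        ∀ p, G.cofactor l (Ψ p).1 = G.cofactor l' p.1) ∧
      G.splLEAt l 2 v₀ = G.splHomAt l 2 v₀) ∧
    Nonempty (G.splLE l' 2 ≃ₗ[𝕜] G.splLE l 2) := by
  obtain rfl : l' = fun e => affineSq (a e) (b e) (c e) := funext hl'
  obtain rfl : l = fun e => affineSq (a e) (b e) 0 := funext hl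
  refine ⟨fun v₀ => ⟨⟨LinearEquiv.ofBijective _ (topPart_bijective hG hab H v₀),
    cofactor_topPart hab v₀⟩, splLEAt_eq_splHomAt hG hab v₀⟩, ?_⟩
  obtain ⟨v₀⟩ := hG.1
  exact ⟨(splLEEquiv _ 2 v₀).trans (((LinearEquiv.refl 𝕜 _).prodCongr
    ((LinearEquiv.ofBijective _ (topPart_bijective hG hab H v₀)).trans
      (LinearEquiv.ofEq _ _ (splLEAt_eq_splHomAt hG hab v₀).symm))).trans
    (splLEEquiv _ 2 v₀).symm)⟩

end labels

end DirGraph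

/-! ### Face cycles of a plane graph -/

theorem dartRev_dartRev {E : Type*} (d : E × Bool) : dartRev (dartRev d) = d := by
  simp [dartRev]

namespace PlaneGraph

variable {V E : Type*} [Fintype V] [Fintype E] (G : PlaneGraph V E)

/-- The face whose boundary walk passes through a dart. -/
def face (d : E × Bool) : Quotient (Equiv.Perm.SameCycle.setoid (G.rot * dartRev)) :=
  Quotient.mk _ d

theorem face_rot_dartRev (d : E × Bool) : G.face (G.rot (dartRev d)) = G.face d := by
  refine Quotient.sound ?_
  change (G.rot * dartRev).SameCycle _ _
  exact Equiv.Perm.sameCycle_apply_left.2 (Equiv.Perm.SameCycle.refl _ _)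

theorem hasDart_iff {F : G.BoundedFace} {d : E × Bool} : G.HasDart F d ↔ G.face d = F.1 := Iff.rfl

/-- A function on the faces that takes the same value on both sides of every edge is constant. -/
theorem eq_of_face_dartRev {k : Type*} [AddCommGroup k]
    (μ : Quotient (Equiv.Perm.SameCycle.setoid (G.rot * dartRev)) → k)
    (h : ∀ e, μ (G.face (e, true)) = μ (G.face (e, false))) (F F' : Quotient _) : μ F = μ F' := by
  classical
  have hrev : ∀ d, μ (G.face (dartRev d)) = μ (G.face d) := by
    rintro ⟨e, _ | _⟩
    · exact h e
    · exact (h e).symm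
  -- Darts that follow each other around a vertex border faces separated by an edge, so `μ` is
  -- constant around each vertex.
  have hrot : ∀ d, μ (G.face (G.rot d)) = μ (G.face d) := fun d => by
    have := G.face_rot_dartRev (dartRev d)
    rw [dartRev_dartRev] at this
    rw [this, hrev]
  have hpow : ∀ (n : ℕ) d, μ (G.face ((G.rot ^ n) d)) = μ (G.face d) := by
    intro n
    induction n with
    | zero => simp
    | succ n ih => intro d; rw [pow_succ, Equiv.Perm.mul_apply, ih, hrot]
  have hsrc : ∀ d d', G.src d = G.src d' → μ (G.face d) = μ (G.face d') := fun d d' hd => by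
    obtain ⟨n, hn⟩ := ((G.rot_sameCycle_iff d d').2 hd).exists_nat_pow_eq
    rw [← hn, hpow]
  -- `μ` descends to the vertices; the default `0` is used only at a vertex without darts.
  let ν : V → k := fun v => if hv : ∃ d, G.src d = v then μ (G.face hv.choose) else 0
  have hν : ∀ d, ν (G.src d) = μ (G.face d) := fun d => by
    have hv : ∃ d', G.src d' = G.src d := ⟨d, rfl⟩
    simp only [ν, dif_pos hv]
    exact hsrc _ _ hv.choose_spec
  have hconst : ∀ u v, ν v - ν u ∈ (⊥ : AddSubgroup k) := G.connected.sub_mem ⊥ fun e => by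
    have h1 := hν (e, true)
    have h2 := hν (e, false)
    simp only [DirGraph.src, if_true] at h1 h2
    rw [AddSubgroup.mem_bot, h1, sub_eq_zero, h e]
    exact h2
  obtain ⟨d, rfl⟩ := Quotient.exists_rep F
  obtain ⟨d', rfl⟩ := Quotient.exists_rep F'
  have := hconst (G.src d') (G.src d)
  rw [AddSubgroup.mem_bot, sub_eq_zero, hν, hν] at this
  exact this

/-- The boundary walk of a face is closed. -/
theorem sum_cycleMatrix_smul_sub {k W : Type*} [Field k] [AddCommGroup W] [Module k W]
    (F : G.BoundedFace) (p : V → W) :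
    ∑ e, (G.cycleMatrix F e : k) • (p (G.head e) - p (G.tail e)) = 0 := by
  classical
  -- The sum is taken over darts instead of edges; a bridge inside `F` contributes two opposite
  -- terms.
  have h1 : ∑ e, (G.cycleMatrix F e : k) • (p (G.head e) - p (G.tail e)) =
      ∑ d : E × Bool, if G.HasDart F d then p (G.src (dartRev d)) - p (G.src d) else 0 := by
    rw [Fintype.sum_prod_type]
    refine Finset.sum_congr rfl fun e _ => ?_
    simp only [Fintype.sum_bool, cycleMatrix, DirGraph.src, dartRev, Equiv.coe_fn_mk]
    by_cases ht : G.HasDart F (e, true) <;> by_cases hf : G.HasDart F (e, false) <;> simp [ht, hf]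
  have h2 : ∀ d, p (G.src (G.rot (dartRev d))) = p (G.src (dartRev d)) := fun d => by
    rw [(G.rot_sameCycle_iff _ _).1 (Equiv.Perm.sameCycle_apply_left.2
      (Equiv.Perm.SameCycle.refl _ (dartRev d)))]
  -- `rot * dartRev` permutes the darts of `F`, and each dart ends where its successor starts.
  have h3 : ∑ d : E × Bool, (if G.HasDart F d then p (G.src (dartRev d)) else 0) =
      ∑ d : E × Bool, (if G.HasDart F d then p (G.src d) else 0) := by
    rw [← Equiv.sum_comp (G.rot * dartRev) fun d => if G.HasDart F d then p (G.src d) else 0]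
    refine Finset.sum_congr rfl fun d _ => ?_
    simp only [Equiv.Perm.mul_apply, h2, hasDart_iff, face_rot_dartRev]
  rw [← sub_eq_zero, ← Finset.sum_sub_distrib] at h3
  rw [h1]
  refine Eq.trans ?_ h3
  refine Finset.sum_congr rfl fun d _ => ?_
  split_ifs <;> simp

/-- The coefficients of a relation, extended by zero to the outer face, agree on both sides of every
edge. They are therefore constant, hence equal to the outer value zero. -/
theorem linearIndependent_cycleMatrix (k : Type*) [Field k] :
    LinearIndependent k fun F : G.BoundedFace => fun e : E => (G.cycleMatrix F e : k) := by
  classical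
  have : Finite G.BoundedFace := inferInstance
  cases nonempty_fintype G.BoundedFace
  rw [Fintype.linearIndependent_iff]
  intro g hg F
  let μ : Quotient (Equiv.Perm.SameCycle.setoid (G.rot * dartRev)) → k :=
    fun F => if hF : F ∉ G.outer then g ⟨F, hF⟩ else 0
  have hμ : ∀ d, ∑ F : G.BoundedFace, g F * (if G.HasDart F d then 1 else 0) = μ (G.face d) := by
    intro d
    by_cases hF : G.face d ∉ G.outer
    · simp only [μ, dif_pos hF]
      rw [Finset.sum_eq_single ⟨G.face d, hF⟩]
      · simp [hasDart_iff]
      · intro F' _ hF'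
        rw [if_neg, mul_zero]
        rw [hasDart_iff]
        exact fun h => hF' (Subtype.ext h.symm)
      · simp
    · simp only [μ, dif_neg hF]
      refine Finset.sum_eq_zero fun F' _ => ?_
      rw [if_neg, mul_zero]
      rw [hasDart_iff]
      exact fun h => hF (h ▸ F'.2)
  have hμe : ∀ e, μ (G.face (e, true)) = μ (G.face (e, false)) := fun e => by
    have := congrFun hg e
    simp only [Finset.sum_apply, Pi.smul_apply, smul_eq_mul, Pi.zero_apply, cycleMatrix,
      Int.cast_sub, Int.cast_ite, Int.cast_one, Int.cast_zero, mul_sub,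
      Finset.sum_sub_distrib] at this
    rw [hμ, hμ] at this
    exact sub_eq_zero.1 this
  obtain ⟨d, hd⟩ := Quotient.exists_rep F.1
  obtain ⟨F₀, hF₀⟩ := G.exists_outer ⟨d.1⟩
  have h1 : μ F.1 = g F := by simp only [μ, dif_pos F.2]
  have h2 : μ F₀ = 0 := by simp [μ, hF₀]
  rw [← h1, G.eq_of_face_dartRev μ hμe F.1 F₀, h2]

/-- The face cycles form a basis of the cycle space: a function on the edges that sums to zero
around every bounded face is a difference of vertex values. -/
theorem exists_of_sum_cycleMatrix_eq_zero {k : Type*} [Field k] (z : E → k)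
    (hz : ∀ F, ∑ e, (G.cycleMatrix F e : k) * z e = 0) :
    ∃ p : V → k, ∀ e, p (G.head e) - p (G.tail e) = z e := by
  classical
  have : Finite G.BoundedFace := inferInstance
  cases nonempty_fintype G.BoundedFace
  let D : (V → k) →ₗ[k] (E → k) :=
    { toFun := fun f e => f (G.head e) - f (G.tail e)
      map_add' := fun f g => by ext e; simp [add_sub_add_comm]
      map_smul' := fun r f => by ext e; simp [mul_sub] }
  let M : Matrix G.BoundedFace E k := fun F e => (G.cycleMatrix F e : k)
  have hM : M.rank = Fintype.card G.BoundedFace :=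
    (G.linearIndependent_cycleMatrix k).rank_matrix
  have hle : LinearMap.range D ≤ LinearMap.ker M.mulVecLin := by
    rintro _ ⟨p, rfl⟩
    rw [LinearMap.mem_ker]
    funext F
    exact G.sum_cycleMatrix_smul_sub (k := k) F p
  have hker : Module.finrank k (LinearMap.ker D) = 1 := by
    have : LinearMap.ker D = Submodule.span k {fun _ => 1} := by
      ext p
      rw [LinearMap.mem_ker, Submodule.mem_span_singleton]
      constructor
      · intro hp
        obtain ⟨v₀⟩ := G.connected.1
        refine ⟨p v₀, ?_⟩
        refine G.connected.eq_of_diff_eq (v₀ := v₀) (by simp) fun e => ?_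
        have := congrFun hp e
        simp only [Pi.smul_apply, smul_eq_mul, mul_one, sub_self]
        exact this.symm
      · rintro ⟨r, rfl⟩
        funext e
        simp [D]
    rw [this]
    obtain ⟨v₀⟩ := G.connected.1
    exact finrank_span_singleton fun h => one_ne_zero (congrFun h v₀)
  have h1 := D.finrank_range_add_finrank_ker
  have h2 := M.mulVecLin.finrank_range_add_finrank_ker
  have h3 := G.euler
  rw [hker, Module.finrank_fintype_fun_eq_card] at h1
  rw [Module.finrank_fintype_fun_eq_card] at h2
  simp only [Nat.card_eq_fintype_card] at h3
  have h4 : Module.finrank k (LinearMap.range M.mulVecLin) = Fintype.card G.BoundedFace := hM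
  -- The potential differences have dimension `#V - 1`, the kernel of `M` has dimension `#E -
  -- #(bounded faces)`, and Euler's formula equates the two.
  have heq := Submodule.eq_of_le_of_finrank_eq hle (by lia)
  have hmem : z ∈ LinearMap.ker M.mulVecLin := by
    rw [LinearMap.mem_ker]
    funext F
    exact hz F
  rw [← heq] at hmem
  obtain ⟨p, hp⟩ := hmem
  exact ⟨p, fun e => congrFun hp e⟩

variable {𝕜 : Type*} [Field 𝕜]

/-- The same for functions with values in a vector space. -/
theorem exists_of_sum_cycleMatrix_smul_eq_zero {W : Type*} [AddCommGroup W] [Module 𝕜 W]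
    (z : E → W) (hz : ∀ F, ∑ e, (G.cycleMatrix F e : 𝕜) • z e = 0) :
    ∃ p : V → W, ∀ e, p (G.head e) - p (G.tail e) = z e := by
  refine exists_potential (k := 𝕜) G.tail G.head z fun c hc => ?_
  -- Linear functionals detect zero, which reduces the claim to scalar edge functions.
  rw [← Module.forall_dual_apply_eq_zero_iff 𝕜]
  intro φ
  obtain ⟨p, hp⟩ := G.exists_of_sum_cycleMatrix_eq_zero (fun e => φ (z e)) fun F => by
    simpa using congrArg φ (hz F)
  simp only [map_sum, map_smul, smul_eq_mul, ← hp]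
  exact hc p

end PlaneGraph

/-! ### Translating the labels of a face to a common zero -/

/-- The substitution `x ↦ x - x₀`, `y ↦ y - y₀`. -/
noncomputable def polyTranslate {𝕜 : Type*} [Field 𝕜] (x₀ y₀ : 𝕜) :
    MvPolynomial (Fin 2) 𝕜 →ₐ[𝕜] MvPolynomial (Fin 2) 𝕜 :=
  aeval ![X 0 - C x₀, X 1 - C y₀]

theorem polyTranslate_affineSq {𝕜 : Type*} [Field 𝕜] {a b c x₀ y₀ : 𝕜} (h : a * x₀ + b * y₀ + c = 0) :
    polyTranslate x₀ y₀ (affineSq a b 0) = affineSq a b c := by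
  obtain rfl : c = -(a * x₀ + b * y₀) := by linear_combination h
  simp only [polyTranslate, affineSq, map_pow, map_add, map_mul, algHom_C, algebraMap_eq, aeval_X,
    Matrix.cons_val_zero, Matrix.cons_val_one, map_neg, map_zero]
  ring

/-- Comparison of the coefficients of `x²`, `2xy` and `y²`; the factor `2` is where characteristic
zero is needed. -/
theorem sum_C_mul_affineSq_eq_zero_iff {E 𝕜 : Type*} [Fintype E] [Field 𝕜] [CharZero 𝕜]
    (w a b : E → 𝕜) : ∑ e, C (w e) * affineSq (a e) (b e) 0 = 0 ↔
      ∑ e, w e * a e ^ 2 = 0 ∧ ∑ e, w e * (a e * b e) = 0 ∧ ∑ e, w e * b e ^ 2 = 0 := by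
  have h : ∑ e, C (w e) * affineSq (a e) (b e) 0 =
      C (∑ e, w e * a e ^ 2) * X 0 ^ 2 + C (∑ e, w e * (a e * b e)) * (2 * (X 0 * X 1)) +
        C (∑ e, w e * b e ^ 2) * X 1 ^ 2 := by
    simp only [map_sum, Finset.sum_mul, ← Finset.sum_add_distrib]
    refine Finset.sum_congr rfl fun e _ => ?_
    simp only [affineSq, map_mul, map_pow, map_zero]
    ring
  constructor
  · intro h0
    rw [h] at h0
    have h1 := congrArg (eval ![1, 0]) h0
    have h2 := congrArg (eval ![0, 1]) h0
    have h3 := congrArg (eval ![1, 1]) h0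
    simp only [map_add, map_mul, eval_C, map_pow, eval_X, map_ofNat, Matrix.cons_val_zero,
      Matrix.cons_val_one, map_zero] at h1 h2 h3
    have h1' : ∑ e, w e * a e ^ 2 = 0 := by linear_combination h1
    have h2' : ∑ e, w e * b e ^ 2 = 0 := by linear_combination h2
    rw [h1', h2'] at h3
    have h3' : 2 * ∑ e, w e * (a e * b e) = 0 := by linear_combination h3
    exact ⟨h1', by simpa using h3', h2'⟩
  · rintro ⟨h1, h2, h3⟩
    simp [h, h1, h2, h3]

namespace PlaneGraph

variable {V E : Type*} [Fintype V] [Fintype E] (G : PlaneGraph V E) {𝕜 : Type*} [Field 𝕜]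

theorem cycleMatrix_eq_zero {F : G.BoundedFace} {e : E} (h : ¬ G.OnFaceCycle F e) :
    G.cycleMatrix F e = 0 := by
  rw [OnFaceCycle, xor_def] at h
  simp only [cycleMatrix]
  by_cases h1 : G.HasDart F (e, true) <;> by_cases h2 : G.HasDart F (e, false) <;>
    simp_all

variable {a b c : E → 𝕜}

theorem sum_cycleMatrix_homogeneous_eq_zero {z : E → 𝕜} {F : G.BoundedFace}
    (h : ∑ e, (G.cycleMatrix F e : 𝕜) • (C (z e) * affineSq (a e) (b e) (c e)) = 0) :
    ∑ e, (G.cycleMatrix F e : 𝕜) • (C (z e) * affineSq (a e) (b e) 0) = 0 := by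
  simpa [homogeneousComponent_C_mul, homogeneousComponent_affineSq] using
    congrArg (homogeneousComponent 2) h

/-- One translation, to the common zero on the cycle of `F`, carries every homogeneous label there
to its affine label; all other edges have coefficient zero. -/
theorem FaceTranslatable.sum_cycleMatrix_eq_zero
    (hG : G.FaceTranslatable fun e => affineSq (a e) (b e) (c e)) {z : E → 𝕜} {F : G.BoundedFace}
    (h : ∑ e, (G.cycleMatrix F e : 𝕜) • (C (z e) * affineSq (a e) (b e) 0) = 0) :
    ∑ e, (G.cycleMatrix F e : 𝕜) • (C (z e) * affineSq (a e) (b e) (c e)) = 0 := by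
  obtain ⟨x₀, y₀, hF⟩ := hG F
  rw [← map_zero (polyTranslate x₀ y₀), ← h, map_sum]
  refine Finset.sum_congr rfl fun e _ => ?_
  by_cases he : G.OnFaceCycle F e
  · have h0 : a e * x₀ + b e * y₀ + c e = 0 := by
      simpa [affineSq] using hF e he
    rw [map_smul, map_mul, polyTranslate_affineSq h0, algHom_C, algebraMap_eq]
  · simp [G.cycleMatrix_eq_zero he]

theorem extMatrix_mulVec_eq_zero_iff [CharZero 𝕜] {z : E → 𝕜} :
    (G.extMatrix a b).mulVec z = 0 ↔
      ∀ F, ∑ e, (G.cycleMatrix F e : 𝕜) • (C (z e) * affineSq (a e) (b e) 0) = 0 := by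
  have h1 : ∀ F, ∑ e, (G.cycleMatrix F e : 𝕜) • (C (z e) * affineSq (a e) (b e) 0) =
      ∑ e, C (G.cycleMatrix F e * z e) * affineSq (a e) (b e) 0 := fun F =>
    Finset.sum_congr rfl fun e _ => by rw [smul_eq_C_mul, map_mul, mul_assoc]
  simp only [h1, sum_C_mul_affineSq_eq_zero_iff, funext_iff, Prod.forall, Fin.forall_fin_succ,
    Matrix.mulVec, dotProduct, extMatrix, Pi.zero_apply, mul_right_comm _ (z _)]
  simp

theorem cofactor_image_splLE [CharZero 𝕜] (hab : ∀ e, a e ≠ 0 ∨ b e ≠ 0)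
    (hG : G.FaceTranslatable fun e => affineSq (a e) (b e) (c e)) :
    G.cofactor (fun e => affineSq (a e) (b e) (c e)) ''
        (G.splLE (fun e => affineSq (a e) (b e) (c e)) 2 : Set (V → MvPolynomial (Fin 2) 𝕜)) =
      {f | ∃ z : E → 𝕜, (G.extMatrix a b).mulVec z = 0 ∧ ∀ e, f e = C (z e)} := by
  ext f
  constructor
  · rintro ⟨p, hp, rfl⟩
    obtain ⟨z, hz⟩ := DirGraph.exists_const_of_mem_splLE hab hp
    refine ⟨z, G.extMatrix_mulVec_eq_zero_iff.2 fun F => ?_, fun e =>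
      DirGraph.cofactor_eq (affineSq_ne_zero (c e) (hab e)) (hz e)⟩
    refine G.sum_cycleMatrix_homogeneous_eq_zero (c := c) ?_
    simp only [← hz]
    exact G.sum_cycleMatrix_smul_sub F p
  · rintro ⟨z, hz, hf⟩
    obtain ⟨p, hp⟩ := G.exists_of_sum_cycleMatrix_smul_eq_zero (𝕜 := 𝕜) _ fun F =>
      hG.sum_cycleMatrix_eq_zero G (G.extMatrix_mulVec_eq_zero_iff.1 hz F)
    obtain ⟨v₀⟩ := G.connected.1
    refine ⟨_, (DirGraph.mem_splLEAt.1 (G.connected.sub_mem_splLEAt v₀ hp)).1, ?_⟩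
    funext e
    rw [hf]
    exact DirGraph.cofactor_eq (affineSq_ne_zero (c e) (hab e))
      ((sub_sub_sub_cancel_right _ _ _).trans (hp e))

/-- Supplies the lifting property of `topPart_bijective` for plane graphs. -/
theorem FaceTranslatable.exists_lift
    (hG : G.FaceTranslatable fun e => affineSq (a e) (b e) (c e)) (z : E → 𝕜)
    (q : V → MvPolynomial (Fin 2) 𝕜)
    (hq : ∀ e, q (G.head e) - q (G.tail e) = C (z e) * affineSq (a e) (b e) 0) :
    ∃ p : V → MvPolynomial (Fin 2) 𝕜,
      ∀ e, p (G.head e) - p (G.tail e) = C (z e) * affineSq (a e) (b e) (c e) := by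
  refine G.exists_of_sum_cycleMatrix_smul_eq_zero (𝕜 := 𝕜) _ fun F =>
    hG.sum_cycleMatrix_eq_zero G ?_
  simp only [← hq]
  exact G.sum_cycleMatrix_smul_sub F q

end PlaneGraph

/-! ### Normal form of the labels -/

theorem totalDegree_aeval_le_of_isHomogeneous {σ τ R : Type*} [CommRing R] {d : ℕ}
    {f : σ → MvPolynomial τ R} (hf : ∀ i, (f i).IsHomogeneous 1) {p : MvPolynomial σ R}
    (hp : p.totalDegree ≤ d) : (aeval f p).totalDegree ≤ d := by
  rw [← sum_homogeneousComponent p, map_sum]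
  refine totalDegree_finsetSum_le fun i hi => ?_
  refine ((homogeneousComponent_isHomogeneous i p).aeval f hf).totalDegree_le.trans ?_
  have := Finset.mem_range.1 hi
  lia

section rotation

variable {𝕜 : Type*} [Field 𝕜]

/-- The similarity `x ↦ r x - s y`, `y ↦ s x + r y`. -/
noncomputable def similarityHom (r s : 𝕜) : MvPolynomial (Fin 2) 𝕜 →ₐ[𝕜] MvPolynomial (Fin 2) 𝕜 :=
  aeval ![C r * X 0 - C s * X 1, C s * X 0 + C r * X 1]

theorem similarityHom_X_zero (r s : 𝕜) : similarityHom r s (X 0) = C r * X 0 - C s * X 1 := by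
  simp [similarityHom]

theorem similarityHom_X_one (r s : 𝕜) : similarityHom r s (X 1) = C s * X 0 + C r * X 1 := by
  simp [similarityHom]

/-- The hypotheses say `(r + i s)(r' + i s') = 1` for a formal `i` with `i² = -1`; similarities
compose like such numbers. -/
theorem similarityHom_comp {r s r' s' : 𝕜} (h₁ : r * r' - s * s' = 1) (h₂ : r * s' + s * r' = 0) :
    (similarityHom r s).comp (similarityHom r' s') = AlgHom.id 𝕜 _ := by
  have h₁' : (C r * C r' - C s * C s' : MvPolynomial (Fin 2) 𝕜) = 1 := by
    simp only [← C_mul, ← C_sub, h₁, C_1]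
  have h₂' : (C r * C s' + C s * C r' : MvPolynomial (Fin 2) 𝕜) = 0 := by
    simp only [← C_mul, ← C_add, h₂, C_0]
  ext i
  fin_cases i
  · simp only [Fin.zero_eta, AlgHom.comp_apply, similarityHom_X_zero, map_sub, map_mul, algHom_C,
      algebraMap_eq, similarityHom_X_one, AlgHom.id_apply]
    congr 1
    linear_combination X 0 * h₁' - X 1 * h₂'
  · simp only [Fin.mk_one, AlgHom.comp_apply, similarityHom_X_zero, map_add, map_mul, algHom_C,
      algebraMap_eq, similarityHom_X_one, AlgHom.id_apply]
    congr 1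
    linear_combination X 1 * h₁' + X 0 * h₂'

/-- The similarity as an automorphism. -/
noncomputable def similarity (r s : 𝕜) (h : r ^ 2 + s ^ 2 ≠ 0) :
    MvPolynomial (Fin 2) 𝕜 ≃ₐ[𝕜] MvPolynomial (Fin 2) 𝕜 :=
  AlgEquiv.ofAlgHom (similarityHom r s) (similarityHom (r / (r ^ 2 + s ^ 2)) (-s / (r ^ 2 + s ^ 2)))
    (similarityHom_comp (by field_simp; ring) (by field_simp; ring))
    (similarityHom_comp (by field_simp; ring) (by field_simp; ring))

theorem similarityHom_isHomogeneous (r s : 𝕜) (i : Fin 2) :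
    (![C r * X 0 - C s * X 1, C s * X 0 + C r * X 1] i :
      MvPolynomial (Fin 2) 𝕜).IsHomogeneous 1 := by
  fin_cases i
  · exact (isHomogeneous_C_mul_X r 0).sub (isHomogeneous_C_mul_X s 1)
  · exact (isHomogeneous_C_mul_X s 0).add (isHomogeneous_C_mul_X r 1)

theorem totalDegree_similarity_le_iff {r s : 𝕜} (h : r ^ 2 + s ^ 2 ≠ 0) {d : ℕ}
    {p : MvPolynomial (Fin 2) 𝕜} :
    (similarity r s h p).totalDegree ≤ d ↔ p.totalDegree ≤ d := by
  constructor
  · intro hp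
    rw [← (similarity r s h).symm_apply_apply p]
    exact totalDegree_aeval_le_of_isHomogeneous (similarityHom_isHomogeneous _ _) hp
  · exact totalDegree_aeval_le_of_isHomogeneous (similarityHom_isHomogeneous _ _)

theorem similarity_affineSq {r s a b : 𝕜} (c : 𝕜) (h : r ^ 2 + s ^ 2 ≠ 0)
    (hr : a * r + b * s ≠ 0) :
    similarity r s h (affineSq a b c) = C ((a * r + b * s) ^ 2) *
      affineSq 1 ((b * r - a * s) / (a * r + b * s)) (c / (a * r + b * s)) := by
  change similarityHom r s _ = _
  have h1 : (C (a * r + b * s) * C ((b * r - a * s) / (a * r + b * s)) :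
      MvPolynomial (Fin 2) 𝕜) = C b * C r - C a * C s := by
    simp only [← C_mul, ← C_sub]
    congr 1
    field_simp
  have h2 : (C (a * r + b * s) * C (c / (a * r + b * s)) : MvPolynomial (Fin 2) 𝕜) = C c := by
    simp only [← C_mul]
    congr 1
    field_simp
  simp only [affineSq, map_pow, map_add, map_mul, algHom_C, algebraMap_eq, similarityHom_X_zero,
    similarityHom_X_one, map_one, one_mul] at h1 h2 ⊢
  rw [← mul_pow]
  congr 1
  linear_combination -X 1 * h1 - h2

/-- The conditions exclude the roots of a nonzero polynomial in `t`, and the field is infinite. -/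
theorem exists_forall_add_mul_ne_zero {E : Type*} [Finite E] [Infinite 𝕜] (a b : E → 𝕜)
    (hab : ∀ e, a e ≠ 0 ∨ b e ≠ 0) : ∃ t : 𝕜, 1 ^ 2 + t ^ 2 ≠ 0 ∧ ∀ e, a e * 1 + b e * t ≠ 0 := by
  cases nonempty_fintype E
  let P : Polynomial 𝕜 := (1 + Polynomial.X ^ 2) *
    ∏ e, (Polynomial.C (a e) + Polynomial.C (b e) * Polynomial.X)
  have hP : P ≠ 0 := by
    refine mul_ne_zero (fun h => ?_) (Finset.prod_ne_zero_iff.2 fun e _ h => ?_)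
    · simpa [Polynomial.coeff_one] using congrArg (fun p => Polynomial.coeff p 2) h
    · rcases hab e with h' | h'
      · simpa [h'] using congrArg (fun p => Polynomial.coeff p 0) h
      · simpa [h', Polynomial.coeff_C] using congrArg (fun p => Polynomial.coeff p 1) h
  obtain ⟨t, ht⟩ : ∃ t, P.eval t ≠ 0 := by
    by_contra! h
    exact hP (Polynomial.funext fun t => by simpa using h t)
  simp only [P, Polynomial.eval_mul, Polynomial.eval_prod] at ht
  refine ⟨t, by simpa using left_ne_zero_of_mul ht, fun e => ?_⟩
  simpa using Finset.prod_ne_zero_iff.1 (right_ne_zero_of_mul ht) e (Finset.mem_univ e)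

end rotation

theorem DirGraph.similarity_mem_splLE_iff {V E : Type*} (G : DirGraph V E) {𝕜 : Type*} [Field 𝕜]
    {r s : 𝕜} (h : r ^ 2 + s ^ 2 ≠ 0) {u : E → 𝕜} (hu : ∀ e, u e ≠ 0)
    {l l₁ : E → MvPolynomial (Fin 2) 𝕜} (hl : ∀ e, similarity r s h (l e) = C (u e) * l₁ e)
    {d : ℕ} {p : V → MvPolynomial (Fin 2) 𝕜} :
    p ∈ G.splLE l d ↔ (fun v => similarity r s h (p v)) ∈ G.splLE l₁ d := by
  simp only [mem_splLE, totalDegree_similarity_le_iff, ← map_sub]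
  refine and_congr_left' (forall_congr' fun e => ?_)
  rw [← map_dvd_iff (similarity r s h), hl]
  exact (((hu e).isUnit).map C).mul_left_dvd

theorem PlaneGraph.exists_normal_form {V E : Type*} [Fintype V] [Fintype E] (G : PlaneGraph V E)
    {𝕜 : Type*} [Field 𝕜] [Infinite 𝕜] {a b c : E → 𝕜} (hab : ∀ e, a e ≠ 0 ∨ b e ≠ 0)
    (hG : G.FaceTranslatable fun e => affineSq (a e) (b e) (c e)) :
    ∃ (τ : MvPolynomial (Fin 2) 𝕜 ≃ₐ[𝕜] MvPolynomial (Fin 2) 𝕜) (x₀ y₀ : 𝕜) (u m s : E → 𝕜),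
      τ (X 0) = C x₀ * X 0 - C y₀ * X 1 ∧ τ (X 1) = C y₀ * X 0 + C x₀ * X 1 ∧
      (∀ e, u e ≠ 0) ∧
      (∀ e, τ (affineSq (a e) (b e) (c e)) = C (u e) * affineSq 1 (m e) (s e)) ∧
      (∀ e, τ (affineSq (a e) (b e) 0) = C (u e) * affineSq 1 (m e) 0) ∧
      G.FaceTranslatable (fun e => affineSq 1 (m e) (s e)) ∧
      (∀ (d : ℕ) (p : V → MvPolynomial (Fin 2) 𝕜),
        (p ∈ G.splLE (fun e => affineSq (a e) (b e) (c e)) d ↔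
          (fun v => τ (p v)) ∈ G.splLE (fun e => affineSq 1 (m e) (s e)) d) ∧
        (p ∈ G.splLE (fun e => affineSq (a e) (b e) 0) d ↔
          (fun v => τ (p v)) ∈ G.splLE (fun e => affineSq 1 (m e) 0) d)) := by
  obtain ⟨t, ht, hu⟩ := exists_forall_add_mul_ne_zero a b hab
  have h1 := fun e => similarity_affineSq (c e) ht (hu e)
  have h2 : ∀ e, similarity 1 t ht (affineSq (a e) (b e) 0) = C ((a e * 1 + b e * t) ^ 2) *
      affineSq 1 ((b e * 1 - a e * t) / (a e * 1 + b e * t)) 0 := fun e => by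
    simpa using similarity_affineSq 0 ht (hu e)
  have hu' : ∀ e, (a e * 1 + b e * t) ^ 2 ≠ 0 := fun e => pow_ne_zero 2 (hu e)
  refine ⟨similarity 1 t ht, 1, t, fun e => (a e * 1 + b e * t) ^ 2,
    fun e => (b e * 1 - a e * t) / (a e * 1 + b e * t), fun e => c e / (a e * 1 + b e * t),
    similarityHom_X_zero 1 t, similarityHom_X_one 1 t, hu', h1, h2, fun F => ?_, fun d p =>
    ⟨G.similarity_mem_splLE_iff ht hu' h1, G.similarity_mem_splLE_iff ht hu' h2⟩⟩
  obtain ⟨x₁, y₁, hF⟩ := hG F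
  -- The solution `(x, y)` of `x - t y = x₁`, `t x + y = y₁`: the old common zero in the new
  -- coordinates.
  refine ⟨(x₁ + t * y₁) / (1 ^ 2 + t ^ 2), (y₁ - t * x₁) / (1 ^ 2 + t ^ 2), fun e he => ?_⟩
  have h0 : a e * x₁ + b e * y₁ + c e = 0 := by simpa [affineSq] using hF e he
  have hue : a e + t * b e ≠ 0 := by simpa [mul_comm t] using hu e
  have ht' : 1 + t ^ 2 ≠ 0 := by simpa using ht
  simp only [one_pow, mul_one, affineSq, map_pow, map_add, map_mul, eval_C, eval_X, Matrix.cons_val_zero,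
    Matrix.cons_val_one]
  refine pow_eq_zero_iff two_ne_zero |>.2 ?_
  field_simp
  linear_combination (1 + t ^ 2) * h0

/-! ### The angle under which a segment is seen -/

section

open Filter Topology ComplexConjugate

section angle

/-- Twice the signed area of the triangle with vertices `v`, `w`, `P`. -/
def cross (v w P : ℝ × ℝ) : ℝ := (v.1 - P.1) * (w.2 - P.2) - (v.2 - P.2) * (w.1 - P.1)

/-- The complex number `conj (v - P) * (w - P)`, whose argument is the angle under which the
oriented segment from `v` to `w` is seen from `P`. -/
def sight (v w P : ℝ × ℝ) : ℂ :=
  ⟨(v.1 - P.1) * (w.1 - P.1) + (v.2 - P.2) * (w.2 - P.2), cross v w P⟩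

/-- The angle under which the oriented segment from `v` to `w` is seen from `P`. -/
noncomputable def visualAngle (v w P : ℝ × ℝ) : ℝ := (sight v w P).arg

theorem cross_rotate (v w P : ℝ × ℝ) : cross w P v = cross v w P := by
  simp only [cross]; ring

theorem cross_swap (v w P : ℝ × ℝ) : cross w v P = -cross v w P := by
  simp only [cross]; ring

theorem cross_combo (v w : ℝ × ℝ) {x y : ℝ × ℝ} {r s : ℝ} (h : r + s = 1) :
    cross v w (r • x + s • y) = r • cross v w x + s • cross v w y := by
  obtain rfl : s = 1 - r := by linarith
  simp only [cross, Prod.fst_add, Prod.snd_add, Prod.smul_fst, Prod.smul_snd, smul_eq_mul]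
  ring

theorem cross_left (v w : ℝ × ℝ) : cross v w v = 0 := by simp [cross]

theorem cross_right (v w : ℝ × ℝ) : cross v w w = 0 := by simp [cross]

theorem cross_eq_zero_of_mem_segment {v w P : ℝ × ℝ} (h : P ∈ segment ℝ v w) :
    cross v w P = 0 := by
  obtain ⟨r, s, -, -, hrs, rfl⟩ := h
  rw [cross_combo v w hrs, cross_left, cross_right]
  simp

@[fun_prop]
theorem continuous_cross (v w : ℝ × ℝ) : Continuous (cross v w) := by
  unfold cross
  fun_prop

theorem continuous_sight (v w : ℝ × ℝ) : Continuous (sight v w) := by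
  have : sight v w = fun P => Complex.equivRealProdCLM.symm
      ((v.1 - P.1) * (w.1 - P.1) + (v.2 - P.2) * (w.2 - P.2), cross v w P) := by
    funext P
    apply Complex.ext <;> simp [sight]
  rw [this]
  fun_prop

/-- The vectors from `P` to `v` and `w` are parallel and do not point the same way. Consequently
`sight` avoids the cut of the argument away from the segment. -/
theorem mem_segment_of_cross_eq_zero {v w P : ℝ × ℝ} (h₀ : cross v w P = 0)
    (h : (sight v w P).re ≤ 0) : P ∈ segment ℝ v w := by
  simp only [sight, cross] at h h₀
  set a₁ := v.1 - P.1 with ha₁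
  set a₂ := v.2 - P.2 with ha₂
  set b₁ := w.1 - P.1 with hb₁
  set b₂ := w.2 - P.2 with hb₂
  by_cases hn : (b₁ - a₁) ^ 2 + (b₂ - a₂) ^ 2 = 0
  · have h1 : b₁ = a₁ := by nlinarith [sq_nonneg (b₁ - a₁), sq_nonneg (b₂ - a₂)]
    have h2 : b₂ = a₂ := by nlinarith [sq_nonneg (b₁ - a₁), sq_nonneg (b₂ - a₂)]
    rw [h1, h2] at h
    have h3 : a₁ = 0 := by nlinarith [sq_nonneg a₁, sq_nonneg a₂]
    have h4 : a₂ = 0 := by nlinarith [sq_nonneg a₁, sq_nonneg a₂]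
    have : P = v := Prod.ext (by linarith) (by linarith)
    rw [this]
    exact left_mem_segment ℝ v w
  · set n := (b₁ - a₁) ^ 2 + (b₂ - a₂) ^ 2 with hn'
    have hpos : 0 < n := lt_of_le_of_ne (by positivity) (Ne.symm hn)
    -- The weights are those of the orthogonal projection of `P` to the line through `v` and `w`.
    refine ⟨(b₁ ^ 2 + b₂ ^ 2 - (a₁ * b₁ + a₂ * b₂)) / n,
      (a₁ ^ 2 + a₂ ^ 2 - (a₁ * b₁ + a₂ * b₂)) / n, ?_, ?_, ?_, ?_⟩
    · exact div_nonneg (by nlinarith [sq_nonneg b₁, sq_nonneg b₂]) hpos.le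
    · exact div_nonneg (by nlinarith [sq_nonneg a₁, sq_nonneg a₂]) hpos.le
    · field_simp
      rw [hn']
      ring
    · have hv₁ : v.1 = P.1 + a₁ := by linarith
      have hv₂ : v.2 = P.2 + a₂ := by linarith
      have hw₁ : w.1 = P.1 + b₁ := by linarith
      have hw₂ : w.2 = P.2 + b₂ := by linarith
      apply Prod.ext
      · simp only [Prod.fst_add, Prod.smul_fst, smul_eq_mul, hv₁, hw₁]
        field_simp
        rw [hn']
        linear_combination (b₂ - a₂) * h₀
      · simp only [Prod.snd_add, Prod.smul_snd, smul_eq_mul, hv₂, hw₂]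
        field_simp
        rw [hn']
        linear_combination (a₁ - b₁) * h₀

theorem sight_mem_slitPlane {v w P : ℝ × ℝ} (h : P ∉ segment ℝ v w) :
    sight v w P ∈ Complex.slitPlane := by
  rw [Complex.mem_slitPlane_iff]
  by_contra! h'
  exact h (mem_segment_of_cross_eq_zero h'.2 h'.1)

theorem continuousAt_visualAngle {v w P : ℝ × ℝ} (h : P ∉ segment ℝ v w) :
    ContinuousAt (visualAngle v w) P :=
  (Complex.continuousAt_arg (sight_mem_slitPlane h)).comp (continuous_sight v w).continuousAt

/-- On arguments: modulo `2π`, the angle seen from `Q` is the angle seen from `P`, plus the turn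
from `P` to `Q` as seen from `w`, minus that seen from `v`. -/
theorem sight_mul (P Q v w : ℝ × ℝ) :
    sight v w P * sight P Q w * conj (sight P Q v) =
      (((v.1 - P.1) ^ 2 + (v.2 - P.2) ^ 2) * ((w.1 - P.1) ^ 2 + (w.2 - P.2) ^ 2) : ℝ) *
        sight v w Q := by
  apply Complex.ext <;> simp only [sight, cross, Complex.mul_re, Complex.mul_im, Complex.conj_re, Complex.conj_im,
    Complex.ofReal_re, Complex.ofReal_im] <;> ring

theorem visualAngle_self {P v : ℝ × ℝ} : visualAngle P P v = 0 := by
  have : sight P P v = (((P.1 - v.1) ^ 2 + (P.2 - v.2) ^ 2 : ℝ) : ℂ) := by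
    apply Complex.ext <;> simp only [sight, cross, Complex.ofReal_re, Complex.ofReal_im] <;> ring
  rw [visualAngle, this, Complex.arg_ofReal_of_nonneg (by positivity)]

theorem sq_add_sq_pos {v P : ℝ × ℝ} (h : P ≠ v) : 0 < (v.1 - P.1) ^ 2 + (v.2 - P.2) ^ 2 := by
  refine lt_of_le_of_ne (by positivity) fun h0 => h (Prod.ext ?_ ?_)
  · nlinarith [sq_nonneg (v.1 - P.1), sq_nonneg (v.2 - P.2)]
  · nlinarith [sq_nonneg (v.1 - P.1), sq_nonneg (v.2 - P.2)]

theorem sight_self_mem_slitPlane {P v : ℝ × ℝ} (h : P ≠ v) :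
    sight P P v ∈ Complex.slitPlane := by
  rw [Complex.mem_slitPlane_iff]
  left
  have := sq_add_sq_pos h
  simp only [sight]
  nlinarith

theorem continuous_sight_middle (P v : ℝ × ℝ) : Continuous fun Q => sight P Q v := by
  have : (fun Q => sight P Q v) = fun Q => Complex.equivRealProdCLM.symm
      ((P.1 - v.1) * (Q.1 - v.1) + (P.2 - v.2) * (Q.2 - v.2),
        (P.1 - v.1) * (Q.2 - v.2) - (P.2 - v.2) * (Q.1 - v.1)) := by
    funext Q
    apply Complex.ext <;> simp [sight, cross]
  rw [this]
  fun_prop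

theorem continuousAt_visualAngle_middle {P v : ℝ × ℝ} (h : P ≠ v) :
    ContinuousAt (fun Q => visualAngle P Q v) P :=
  ContinuousAt.comp (g := Complex.arg) (f := fun Q => sight P Q v)
    (Complex.continuousAt_arg (sight_self_mem_slitPlane h)) (continuous_sight_middle P v).continuousAt

/-- Away from a segment, the change of the angle under which it is seen is the difference of the
angles by which its endpoints see the viewer move. -/
theorem visualAngle_sub_eventually {v w P : ℝ × ℝ} (h : P ∉ segment ℝ v w) :
    ∀ᶠ Q in 𝓝 P,
      visualAngle v w Q - visualAngle v w P = visualAngle P Q w - visualAngle P Q v := by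
  have hPv : P ≠ v := fun h' => h (h' ▸ left_mem_segment ℝ v w)
  have hPw : P ≠ w := fun h' => h (h' ▸ right_mem_segment ℝ v w)
  have hcont : ContinuousAt (fun Q => visualAngle v w Q - visualAngle v w P -
      (visualAngle P Q w - visualAngle P Q v)) P :=
    ((continuousAt_visualAngle h).sub continuousAt_const).sub
      ((continuousAt_visualAngle_middle hPw).sub (continuousAt_visualAngle_middle hPv))
  -- The identity holds modulo `2π` by `sight_mul`. The error is continuous in `Q` and zero at `P`,
  -- so near `P` it is too small to be a nonzero multiple of `2π`.
  have hsmall : ∀ᶠ Q in 𝓝 P, |visualAngle v w Q - visualAngle v w P -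
      (visualAngle P Q w - visualAngle P Q v)| < 2 * Real.pi := by
    refine hcont.abs.eventually_lt continuousAt_const ?_
    simp [visualAngle_self, Real.pi_pos]
  have hne : ∀ {u : ℝ × ℝ}, P ≠ u → ∀ᶠ Q in 𝓝 P, sight P Q u ≠ 0 := fun hu =>
    (continuous_sight_middle P _).continuousAt.eventually_ne
      (Complex.slitPlane_ne_zero (sight_self_mem_slitPlane hu))
  filter_upwards [hsmall, hne hPv, hne hPw] with Q hQ hv hw
  have h0 : sight v w P ≠ 0 := Complex.slitPlane_ne_zero (sight_mem_slitPlane h)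
  have h1 := congrArg (fun z => (Complex.arg z : Real.Angle)) (sight_mul P Q v w)
  rw [Complex.arg_mul_coe_angle (mul_ne_zero h0 hw) (by simpa using hv),
    Complex.arg_mul_coe_angle h0 hw, Complex.arg_conj_coe_angle,
    Complex.arg_real_mul _ (mul_pos (sq_add_sq_pos hPv) (sq_add_sq_pos hPw))] at h1
  have h2 : ((visualAngle v w Q - visualAngle v w P -
      (visualAngle P Q w - visualAngle P Q v) : ℝ) : Real.Angle) = 0 := by
    simp only [visualAngle, Real.Angle.coe_sub, ← h1]
    abel
  rw [Real.Angle.coe_eq_zero_iff] at h2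
  obtain ⟨n, hn⟩ := h2
  rw [← hn, zsmul_eq_mul, abs_mul, abs_of_pos Real.two_pi_pos] at hQ
  have hn1 : |(n : ℝ)| < 1 := by
    have := Real.two_pi_pos
    by_contra! hcon
    nlinarith
  have hn0 : n = 0 := by
    rw [← Int.cast_abs] at hn1
    exact Int.abs_lt_one_iff.1 (by exact_mod_cast hn1)
  rw [hn0, zero_smul, eq_comm, sub_eq_zero] at hn
  exact hn

/-- The point at the relative height `ε` to the left of the midpoint of the segment from `v` to
`w`. -/
noncomputable def sidePoint (v w : ℝ × ℝ) (ε : ℝ) : ℝ × ℝ :=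
  ((v.1 + w.1) / 2 - ε * (w.2 - v.2), (v.2 + w.2) / 2 + ε * (w.1 - v.1))

theorem sidePoint_swap (v w : ℝ × ℝ) (ε : ℝ) : sidePoint w v ε = sidePoint v w (-ε) := by
  apply Prod.ext <;> simp only [sidePoint] <;> ring

@[fun_prop]
theorem continuous_sidePoint (v w : ℝ × ℝ) : Continuous (sidePoint v w) := by
  unfold sidePoint
  fun_prop

theorem sidePoint_zero (v w : ℝ × ℝ) : sidePoint v w 0 = (1 / 2 : ℝ) • v + (1 / 2 : ℝ) • w := by
  apply Prod.ext <;> simp [sidePoint] <;> ring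

theorem cross_sidePoint (v w : ℝ × ℝ) (ε : ℝ) :
    cross v w (sidePoint v w ε) = ε * ((v.1 - w.1) ^ 2 + (v.2 - w.2) ^ 2) := by
  simp only [cross, sidePoint]
  ring

theorem visualAngle_sidePoint {v w : ℝ × ℝ} (h : v ≠ w) (ε : ℝ) :
    visualAngle v w (sidePoint v w ε) = Complex.arg ⟨-1 / 4 + ε ^ 2, ε⟩ := by
  rw [← Complex.arg_real_mul _ (sq_add_sq_pos h.symm), visualAngle]
  congr 1
  apply Complex.ext <;> simp only [sight, cross, sidePoint, Complex.mul_re, Complex.mul_im,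
    Complex.ofReal_re, Complex.ofReal_im] <;> ring

/-- Close to the midpoint `sight` is close to the negative real axis, above it on the left side of
the segment and below it on the right. The one-sided limits thus differ by `2π`. -/
theorem tendsto_visualAngle_left {v w : ℝ × ℝ} (h : v ≠ w) :
    Tendsto (fun ε => visualAngle v w (sidePoint v w ε)) (𝓝[>] 0) (𝓝 Real.pi) := by
  simp only [visualAngle_sidePoint h]
  have hc : Continuous fun ε : ℝ => (⟨-1 / 4 + ε ^ 2, ε⟩ : ℂ) := by
    have : (fun ε : ℝ => (⟨-1 / 4 + ε ^ 2, ε⟩ : ℂ)) =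
        fun ε : ℝ => Complex.equivRealProdCLM.symm (-1 / 4 + ε ^ 2, ε) := by
      funext ε
      apply Complex.ext <;> simp
    rw [this]
    fun_prop
  refine (Complex.tendsto_arg_nhdsWithin_im_nonneg_of_re_neg_of_im_zero
    (z := ⟨-1 / 4 + 0 ^ 2, 0⟩) (by norm_num) rfl).comp ?_
  refine tendsto_nhdsWithin_iff.2 ⟨(hc.tendsto 0).mono_left nhdsWithin_le_nhds, ?_⟩
  filter_upwards [self_mem_nhdsWithin] with ε hε
  exact le_of_lt hε

theorem tendsto_visualAngle_right {v w : ℝ × ℝ} (h : v ≠ w) :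
    Tendsto (fun ε => visualAngle v w (sidePoint v w (-ε))) (𝓝[>] 0) (𝓝 (-Real.pi)) := by
  simp only [visualAngle_sidePoint h]
  have hc : Continuous fun ε : ℝ => (⟨-1 / 4 + (-ε) ^ 2, -ε⟩ : ℂ) := by
    have : (fun ε : ℝ => (⟨-1 / 4 + (-ε) ^ 2, -ε⟩ : ℂ)) =
        fun ε : ℝ => Complex.equivRealProdCLM.symm (-1 / 4 + (-ε) ^ 2, -ε) := by
      funext ε
      apply Complex.ext <;> simp
    rw [this]
    fun_prop
  refine (Complex.tendsto_arg_nhdsWithin_im_neg_of_re_neg_of_im_zero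
    (z := ⟨-1 / 4 + (-0) ^ 2, -0⟩) (by norm_num) (by simp)).comp ?_
  refine tendsto_nhdsWithin_iff.2 ⟨(hc.tendsto 0).mono_left nhdsWithin_le_nhds, ?_⟩
  filter_upwards [self_mem_nhdsWithin] with ε hε
  exact neg_lt_zero.2 (Set.mem_Ioi.1 hε)

end angle

end

/-! ### Edges and triangles of a planar complex -/

section

open Filter Topology

namespace Geometry.SimplicialComplex

variable (K : Geometry.SimplicialComplex ℝ (ℝ × ℝ))

/-- `v` and `w` are the two endpoints of an edge. -/
def IsEdge (v w : ℝ × ℝ) : Prop := v ≠ w ∧ {v, w} ∈ K.faces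

/-- `u`, `v` and `w` are the three vertices of a triangle. -/
def IsTriangle (u v w : ℝ × ℝ) : Prop := u ≠ v ∧ v ≠ w ∧ w ≠ u ∧ {u, v, w} ∈ K.faces

variable {K}

theorem IsEdge.symm {v w : ℝ × ℝ} (h : K.IsEdge v w) : K.IsEdge w v :=
  ⟨h.1.symm, Finset.pair_comm v w ▸ h.2⟩

theorem IsTriangle.rotate {u v w : ℝ × ℝ} (h : K.IsTriangle u v w) : K.IsTriangle v w u := by
  obtain ⟨h1, h2, h3, h4⟩ := h
  refine ⟨h2, h3, h1, ?_⟩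
  convert h4 using 1
  ext x
  simp only [Finset.mem_insert, Finset.mem_singleton]
  tauto

theorem IsTriangle.swap {u v w : ℝ × ℝ} (h : K.IsTriangle u v w) : K.IsTriangle v u w := by
  obtain ⟨h1, h2, h3, h4⟩ := h
  refine ⟨h1.symm, h3.symm, h2.symm, ?_⟩
  convert h4 using 1
  ext x
  simp only [Finset.mem_insert, Finset.mem_singleton]
  tauto

theorem isEdge_of_mem {s : Finset (ℝ × ℝ)} (hs : s ∈ K.faces) {v w : ℝ × ℝ} (hv : v ∈ s)
    (hw : w ∈ s) (h : v ≠ w) : K.IsEdge v w :=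
  ⟨h, K.down_closed hs (by simp [Finset.insert_subset_iff, hv, hw]) (by simp)⟩

theorem IsTriangle.isEdge {u v w : ℝ × ℝ} (h : K.IsTriangle u v w) : K.IsEdge u v :=
  isEdge_of_mem h.2.2.2 (by simp) (by simp) h.1

theorem IsTriangle.cross_ne_zero {u v w : ℝ × ℝ} (h : K.IsTriangle u v w) : cross u v w ≠ 0 := by
  intro h0
  obtain ⟨h1, h2, h3, h4⟩ := h
  have hinj : Function.Injective ![u, v, w] := by
    intro i j hij
    fin_cases i <;> fin_cases j <;> simp_all [eq_comm]
  have hmem : ∀ i, ![u, v, w] i ∈ ({u, v, w} : Finset (ℝ × ℝ)) := by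
    intro i
    fin_cases i <;> simp
  let f : Fin 3 ↪ ({u, v, w} : Finset (ℝ × ℝ)) :=
    ⟨fun i => ⟨![u, v, w] i, hmem i⟩, fun i j hij => hinj (congrArg Subtype.val hij)⟩
  have hind : AffineIndependent ℝ ![u, v, w] := (K.indep h4).comp_embedding f
  rw [affineIndependent_iff_not_collinear_set] at hind
  refine hind ((collinear_iff_of_mem (p₀ := u) (by simp)).2 ⟨v - u, fun p hp => ?_⟩)
  rcases hp with rfl | rfl | rfl
  · exact ⟨0, by simp⟩
  · exact ⟨1, by simp⟩
  · have hpos := sq_add_sq_pos h1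
    refine ⟨((p.1 - u.1) * (v.1 - u.1) + (p.2 - u.2) * (v.2 - u.2)) /
      ((v.1 - u.1) ^ 2 + (v.2 - u.2) ^ 2), ?_⟩
    simp only [cross] at h0
    apply Prod.ext
    · simp only [vadd_eq_add, Prod.fst_add, Prod.smul_fst, Prod.fst_sub, smul_eq_mul]
      field_simp
      linear_combination (u.2 - v.2) * h0
    · simp only [vadd_eq_add, Prod.snd_add, Prod.smul_snd, Prod.snd_sub, smul_eq_mul]
      field_simp
      linear_combination (v.1 - u.1) * h0

/-- If the midpoint of an edge lies in a face, then the edge is contained in the face. -/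
theorem IsEdge.subset_of_midpoint_mem {v w : ℝ × ℝ} (h : K.IsEdge v w) {s : Finset (ℝ × ℝ)}
    (hs : s ∈ K.faces) (hm : sidePoint v w 0 ∈ convexHull ℝ (s : Set (ℝ × ℝ))) :
    v ∈ s ∧ w ∈ s := by
  have hmem : sidePoint v w 0 ∈ convexHull ℝ (({v, w} : Finset (ℝ × ℝ)) : Set (ℝ × ℝ)) := by
    rw [Finset.coe_pair, convexHull_pair, sidePoint_zero]
    exact ⟨1 / 2, 1 / 2, by norm_num, by norm_num, by norm_num, rfl⟩
  -- Two faces meet in the hull of their common vertices; if one endpoint were missing, the midpoint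
  -- would be the other endpoint.
  have hinter := K.inter_subset_convexHull h.2 hs ⟨hmem, hm⟩
  constructor
  · by_contra hv
    have hsub : ((({v, w} : Finset (ℝ × ℝ)) : Set (ℝ × ℝ)) ∩ s) ⊆ {w} := by
      rintro x ⟨hx, hxs⟩
      have hx' : x = v ∨ x = w := by simpa using hx
      rcases hx' with rfl | rfl
      · exact absurd hxs hv
      · rfl
    have := convexHull_mono hsub hinter
    rw [convexHull_singleton, Set.mem_singleton_iff, Prod.ext_iff] at this
    simp only [sidePoint] at this
    exact h.1 (Prod.ext (by linarith [this.1]) (by linarith [this.2]))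
  · by_contra hw
    have hsub : ((({v, w} : Finset (ℝ × ℝ)) : Set (ℝ × ℝ)) ∩ s) ⊆ {v} := by
      rintro x ⟨hx, hxs⟩
      have hx' : x = v ∨ x = w := by simpa using hx
      rcases hx' with rfl | rfl
      · rfl
      · exact absurd hxs hw
    have := convexHull_mono hsub hinter
    rw [convexHull_singleton, Set.mem_singleton_iff, Prod.ext_iff] at this
    simp only [sidePoint] at this
    exact h.1 (Prod.ext (by linarith [this.1]) (by linarith [this.2]))

end Geometry.SimplicialComplex

/-- The interior of the triangle with vertices `u`, `v`, `w`. -/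
def openTriangle (u v w : ℝ × ℝ) : Set (ℝ × ℝ) :=
  {P | 0 < cross u v w * cross u v P ∧ 0 < cross u v w * cross v w P ∧
    0 < cross u v w * cross w u P}

theorem convex_openTriangle (u v w : ℝ × ℝ) : Convex ℝ (openTriangle u v w) := by
  intro x hx y hy r s hr hs hrs
  simp only [openTriangle, Set.mem_ofPred_eq, cross_combo _ _ hrs] at hx hy ⊢
  have key : ∀ {D X Y : ℝ}, 0 < D * X → 0 < D * Y → 0 < D * (r • X + s • Y) := by
    intro D X Y hX hY
    have := (convex_Ioi (0 : ℝ)) hX hY hr hs hrs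
    simp only [Set.mem_Ioi, smul_eq_mul] at this ⊢
    linarith
  exact ⟨key hx.1 hy.1, key hx.2.1 hy.2.1, key hx.2.2 hy.2.2⟩

/-- The centroid of a triangle. -/
noncomputable def centroid₃ (u v w : ℝ × ℝ) : ℝ × ℝ :=
  ((u.1 + v.1 + w.1) / 3, (u.2 + v.2 + w.2) / 3)

theorem centroid₃_mem {u v w : ℝ × ℝ} (h : cross u v w ≠ 0) :
    centroid₃ u v w ∈ openTriangle u v w := by
  have h1 : cross u v (centroid₃ u v w) = cross u v w / 3 := by
    simp only [cross, centroid₃]; ring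
  have h2 : cross v w (centroid₃ u v w) = cross u v w / 3 := by
    simp only [cross, centroid₃]; ring
  have h3 : cross w u (centroid₃ u v w) = cross u v w / 3 := by
    simp only [cross, centroid₃]; ring
  have hpos : 0 < cross u v w * (cross u v w / 3) := by
    have := mul_self_pos.2 h
    linarith
  exact ⟨by rwa [h1], by rwa [h2], by rwa [h3]⟩

theorem openTriangle_subset_convexHull {u v w P : ℝ × ℝ} (hP : P ∈ openTriangle u v w) :
    P ∈ convexHull ℝ (({u, v, w} : Finset (ℝ × ℝ)) : Set (ℝ × ℝ)) := by
  have hD : cross u v w ≠ 0 := fun h0 => by simpa [h0] using hP.1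
  have hD2 : 0 < cross u v w ^ 2 := by positivity
  have hcoef : ∀ {x : ℝ}, 0 < cross u v w * x → 0 ≤ x / cross u v w := fun {x} hx => by
    have : x / cross u v w = cross u v w * x / cross u v w ^ 2 := by field_simp
    rw [this]
    positivity
  have hsum : cross v w P + cross w u P + cross u v P = cross u v w := by
    simp only [cross]; ring
  -- Barycentric coordinates are ratios of signed areas.
  have h1 : P = (cross v w P / cross u v w) • u + (cross w u P / cross u v w) • v +
      (cross u v P / cross u v w) • w := by
    apply Prod.ext
    · simp only [Prod.fst_add, Prod.smul_fst, smul_eq_mul]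
      field_simp
      simp only [cross]
      ring
    · simp only [Prod.snd_add, Prod.smul_snd, smul_eq_mul]
      field_simp
      simp only [cross]
      ring
  have h2 : P = ∑ i : Fin 3, (![cross v w P / cross u v w, cross w u P / cross u v w,
      cross u v P / cross u v w] i) • ![u, v, w] i := by
    simpa [Fin.sum_univ_three] using h1
  rw [h2]
  refine (convex_convexHull ℝ _).sum_mem ?_ ?_ ?_
  · intro i _
    fin_cases i
    · exact hcoef hP.2.1
    · exact hcoef hP.2.2
    · exact hcoef hP.1
  · simp only [Fin.sum_univ_three, Matrix.cons_val_zero, Matrix.cons_val_one, Matrix.cons_val]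
    field_simp
    exact hsum
  · intro i _
    refine subset_convexHull ℝ _ ?_
    fin_cases i <;> simp

namespace Geometry.SimplicialComplex

variable {K : Geometry.SimplicialComplex ℝ (ℝ × ℝ)}

/-- If a vertex were missing from `s`, the intersection of the two faces, and with it `P`, would lie
on the opposite side of the triangle. -/
theorem IsTriangle.subset_of_mem_openTriangle {u v w : ℝ × ℝ} (h : K.IsTriangle u v w)
    {P : ℝ × ℝ} (hP : P ∈ openTriangle u v w) {s : Finset (ℝ × ℝ)} (hs : s ∈ K.faces)
    (hPs : P ∈ convexHull ℝ (s : Set (ℝ × ℝ))) : u ∈ s ∧ v ∈ s ∧ w ∈ s := by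
  have hinter := K.inter_subset_convexHull h.2.2.2 hs ⟨openTriangle_subset_convexHull hP, hPs⟩
  have key : ∀ {x y z : ℝ × ℝ}, ({u, v, w} : Set (ℝ × ℝ)) = {x, y, z} → cross y z P ≠ 0 →
      x ∈ s := by
    intro x y z hset hne
    by_contra hx
    have hsub : (({u, v, w} : Finset (ℝ × ℝ)) : Set (ℝ × ℝ)) ∩ s ⊆ {y, z} := by
      rintro p ⟨hp, hps⟩
      have hp' : p ∈ ({x, y, z} : Set (ℝ × ℝ)) := by
        rw [← hset]
        simpa using hp
      rcases hp' with rfl | hp'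
      · exact absurd hps hx
      · exact hp'
    have := convexHull_mono hsub hinter
    rw [convexHull_pair] at this
    exact hne (cross_eq_zero_of_mem_segment this)
  refine ⟨key (y := v) (z := w) rfl ?_, key (y := w) (z := u) ?_ ?_,
    key (y := u) (z := v) ?_ ?_⟩
  · exact right_ne_zero_of_mul hP.2.1.ne'
  · ext x; simp only [Set.mem_insert_iff, Set.mem_singleton_iff]; tauto
  · exact right_ne_zero_of_mul hP.2.2.ne'
  · ext x; simp only [Set.mem_insert_iff, Set.mem_singleton_iff]; tauto
  · exact right_ne_zero_of_mul hP.1.ne'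

variable (K) in
/-- The points of the plane that lie on no edge. -/
def offEdges : Set (ℝ × ℝ) := {P | ∀ v w, K.IsEdge v w → P ∉ segment ℝ v w}

theorem compl_space_subset_offEdges : K.spaceᶜ ⊆ K.offEdges := by
  intro P hP v w h hseg
  refine hP (mem_space_iff.2 ⟨_, h.2, ?_⟩)
  rwa [Finset.coe_pair, convexHull_pair]

theorem IsTriangle.openTriangle_subset_offEdges {u v w : ℝ × ℝ} (h : K.IsTriangle u v w) :
    openTriangle u v w ⊆ K.offEdges := by
  intro P hP x y hxy hseg
  obtain ⟨hu, hv, hw⟩ := h.subset_of_mem_openTriangle hP hxy.2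
    (by rwa [Finset.coe_pair, convexHull_pair])
  obtain ⟨h1, h2, h3, -⟩ := h
  simp only [Finset.mem_insert, Finset.mem_singleton] at hu hv hw
  grind

theorem IsTriangle.sidePoint_eventually_mem_openTriangle {u v w : ℝ × ℝ} (h : K.IsTriangle v w u)
    (hpos : 0 < cross v w u) : ∀ᶠ ε in 𝓝[>] 0, sidePoint v w ε ∈ openTriangle v w u := by
  have h1 : ∀ᶠ ε in 𝓝[>] 0, 0 < cross w u (sidePoint v w ε) := by
    refine Filter.Eventually.filter_mono nhdsWithin_le_nhds ?_
    have hc : Continuous fun ε => cross w u (sidePoint v w ε) := by fun_prop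
    refine hc.continuousAt.eventually_const_lt ?_
    dsimp only
    rw [sidePoint_zero, cross_combo _ _ (by norm_num), cross_left, cross_rotate v]
    simpa using hpos
  have h2 : ∀ᶠ ε in 𝓝[>] 0, 0 < cross u v (sidePoint v w ε) := by
    refine Filter.Eventually.filter_mono nhdsWithin_le_nhds ?_
    have hc : Continuous fun ε => cross u v (sidePoint v w ε) := by fun_prop
    refine hc.continuousAt.eventually_const_lt ?_
    dsimp only
    rw [sidePoint_zero, cross_combo _ _ (by norm_num), cross_right, cross_rotate w,
      cross_rotate v]
    simpa using hpos
  filter_upwards [h1, h2, self_mem_nhdsWithin] with ε h1 h2 hε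
  refine ⟨mul_pos hpos ?_, mul_pos hpos h1, mul_pos hpos h2⟩
  rw [cross_sidePoint]
  exact mul_pos hε (sq_add_sq_pos h.1.symm)

/-- Both open triangles contain the points just left of the midpoint of the common edge, so they
overlap. -/
theorem IsTriangle.eq_of_same_side {u u' v w : ℝ × ℝ} (h : K.IsTriangle v w u)
    (h' : K.IsTriangle v w u') (hpos : 0 < cross v w u) (hpos' : 0 < cross v w u') : u = u' := by
  obtain ⟨ε, h1, h2⟩ := ((IsTriangle.sidePoint_eventually_mem_openTriangle h hpos).and
    (IsTriangle.sidePoint_eventually_mem_openTriangle h' hpos')).exists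
  have := (h.subset_of_mem_openTriangle h1 h'.2.2.2 (openTriangle_subset_convexHull h2)).2.2
  simp only [Finset.mem_insert, Finset.mem_singleton] at this
  obtain ⟨-, g2, g3, -⟩ := h
  rcases this with rfl | rfl | rfl
  · exact absurd rfl g3
  · exact absurd rfl g2
  · rfl

/-- If no triangle lies to the left of an edge, the points close to the left of its midpoint do not
belong to the complex. -/
theorem IsEdge.sidePoint_eventually_notMem_space (hfin : K.faces.Finite) {v w : ℝ × ℝ}
    (h : K.IsEdge v w) (hno : ∀ u, K.IsTriangle v w u → cross v w u ≤ 0) :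
    ∀ᶠ ε in 𝓝[>] 0, sidePoint v w ε ∈ K.spaceᶜ := by
  have hface : ∀ s ∈ K.faces, ∀ᶠ ε in 𝓝[>] 0,
      sidePoint v w ε ∉ convexHull ℝ (s : Set (ℝ × ℝ)) := by
    intro s hs
    -- A face through the midpoint contains the edge and has no vertex to its left, so it lies in a
    -- closed half-plane. Any other face is closed and misses a neighborhood of the midpoint.
    by_cases hm : sidePoint v w 0 ∈ convexHull ℝ (s : Set (ℝ × ℝ))
    · obtain ⟨hv, hw⟩ := h.subset_of_midpoint_mem hs hm
      have hle : ∀ x ∈ s, cross v w x ≤ 0 := by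
        intro x hx
        by_cases hxv : x = v
        · rw [hxv, cross_left]
        by_cases hxw : x = w
        · rw [hxw, cross_right]
        refine hno x ⟨h.1, Ne.symm hxw, hxv, K.down_closed hs ?_ (by simp)⟩
        simp [Finset.insert_subset_iff, hv, hw, hx]
      have hconv : Convex ℝ {P | cross v w P ≤ 0} := by
        intro x hx y hy r t hr ht hrt
        simp only [Set.mem_ofPred_eq] at hx hy ⊢
        rw [cross_combo _ _ hrt]
        exact (convex_Iic (0 : ℝ)) hx hy hr ht hrt
      filter_upwards [self_mem_nhdsWithin] with ε hε hmem
      have : cross v w (sidePoint v w ε) ≤ 0 :=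
        convexHull_min (s := (s : Set (ℝ × ℝ))) hle hconv hmem
      rw [cross_sidePoint] at this
      exact absurd (mul_pos hε (sq_add_sq_pos h.1.symm)) (not_lt.2 this)
    · have hclosed : IsClosed (convexHull ℝ (s : Set (ℝ × ℝ))) :=
        s.finite_toSet.isClosed_convexHull ℝ
      exact Filter.Eventually.filter_mono nhdsWithin_le_nhds
        ((continuous_sidePoint v w).continuousAt.eventually (hclosed.isOpen_compl.mem_nhds hm))
  filter_upwards [(hfin.eventually_all).2 hface] with ε hε hmem
  obtain ⟨s, hs, hmem⟩ := mem_space_iff.1 hmem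
  exact hε s hs hmem

end Geometry.SimplicialComplex

end

/-! ### Winding numbers and the exactness of closed cochains -/

section

open Filter Topology

/-- The winding function of the 1-chain `c` on the complete graph with vertex set `S`. -/
noncomputable def winding (S : Finset (ℝ × ℝ)) (c : ℝ × ℝ → ℝ × ℝ → ℝ) (P : ℝ × ℝ) : ℝ :=
  ∑ v ∈ S, ∑ w ∈ S, c v w * visualAngle v w P

namespace Geometry.SimplicialComplex

variable {K : Geometry.SimplicialComplex ℝ (ℝ × ℝ)} {S : Finset (ℝ × ℝ)}
  {c : ℝ × ℝ → ℝ × ℝ → ℝ}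

/-- By `visualAngle_sub_eventually`, moving from `P` to `Q` changes the winding function by the
pairing of the cycle `c` with a difference of vertex values, which is zero. -/
theorem winding_eventually_eq (hc : ∀ v w, ¬ K.IsEdge v w → c v w = 0)
    (hcyc : ∀ f : ℝ × ℝ → ℝ, ∑ v ∈ S, ∑ w ∈ S, c v w * (f w - f v) = 0) {P : ℝ × ℝ}
    (hP : P ∈ K.offEdges) : ∀ᶠ Q in 𝓝 P, winding S c Q = winding S c P := by
  have h1 : ∀ᶠ Q in 𝓝 P, ∀ v ∈ S, ∀ w ∈ S, K.IsEdge v w →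
      visualAngle v w Q - visualAngle v w P = visualAngle P Q w - visualAngle P Q v := by
    simp only [Finset.eventually_all]
    intro v _ w _
    by_cases h : K.IsEdge v w
    · simpa [h] using visualAngle_sub_eventually (hP v w h)
    · simp [h]
  filter_upwards [h1] with Q hQ
  rw [← sub_eq_zero, winding, winding, ← hcyc fun v => visualAngle P Q v,
    ← Finset.sum_sub_distrib]
  refine Finset.sum_congr rfl fun v hv => ?_
  rw [← Finset.sum_sub_distrib]
  refine Finset.sum_congr rfl fun w hw => ?_
  by_cases h : K.IsEdge v w
  · rw [← mul_sub, hQ v hv w hw h]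
  · simp [hc v w h]

theorem winding_eq_of_isPreconnected (hc : ∀ v w, ¬ K.IsEdge v w → c v w = 0)
    (hcyc : ∀ f : ℝ × ℝ → ℝ, ∑ v ∈ S, ∑ w ∈ S, c v w * (f w - f v) = 0)
    {A : Set (ℝ × ℝ)} (hA : IsPreconnected A) (hsub : A ⊆ K.offEdges) {P Q : ℝ × ℝ} (hP : P ∈ A)
    (hQ : Q ∈ A) : winding S c P = winding S c Q := by
  have : PreconnectedSpace A := Subtype.preconnectedSpace hA
  have hloc : IsLocallyConstant fun x : A => winding S c x.1 :=
    (IsLocallyConstant.iff_eventually_eq _).2 fun x =>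
      continuous_subtype_val.continuousAt.eventually
        (winding_eventually_eq hc hcyc (hsub x.2))
  exact hloc.apply_eq_of_preconnectedSpace ⟨P, hP⟩ ⟨Q, hQ⟩

/-- The jump of the winding function across an edge. -/
theorem IsEdge.tendsto_winding_jump (hc : ∀ v w, ¬ K.IsEdge v w → c v w = 0) {v w : ℝ × ℝ}
    (h : K.IsEdge v w) (hv : v ∈ S) (hw : w ∈ S) :
    Tendsto (fun ε => winding S c (sidePoint v w ε) - winding S c (sidePoint v w (-ε))) (𝓝[>] 0)
      (𝓝 (2 * Real.pi * (c v w - c w v))) := by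
  classical
  have hterm : ∀ x y, Tendsto (fun ε => c x y * visualAngle x y (sidePoint v w ε) -
      c x y * visualAngle x y (sidePoint v w (-ε))) (𝓝[>] 0)
      (𝓝 ((if x = v then if y = w then 2 * Real.pi * c v w else 0 else 0) -
        (if x = w then if y = v then 2 * Real.pi * c w v else 0 else 0))) := by
    intro x y
    by_cases hxy : K.IsEdge x y
    · by_cases hm : sidePoint v w 0 ∈ segment ℝ x y
      · obtain ⟨h1, h2⟩ := h.subset_of_midpoint_mem hxy.2
          (by rwa [Finset.coe_pair, convexHull_pair])
        simp only [Finset.mem_insert, Finset.mem_singleton] at h1 h2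
        have hcase : (x = v ∧ y = w) ∨ (x = w ∧ y = v) := by
          have := h.1
          grind
        rcases hcase with ⟨rfl, rfl⟩ | ⟨rfl, rfl⟩
        · convert ((tendsto_visualAngle_left h.1).const_mul (c x y)).sub
            ((tendsto_visualAngle_right h.1).const_mul (c x y)) using 2
          simp only [if_true, if_neg h.1, sub_zero]
          ring
        · convert ((tendsto_visualAngle_right hxy.1).const_mul (c x y)).sub
            ((tendsto_visualAngle_left hxy.1).const_mul (c x y)) using 2 with ε
          · rw [sidePoint_swap x y, sidePoint_swap x y, neg_neg]
          · simp only [if_true, if_neg hxy.1, zero_sub]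
            ring
      · have hlim : (if x = v then if y = w then 2 * Real.pi * c v w else 0 else 0) -
            (if x = w then if y = v then 2 * Real.pi * c w v else 0 else 0) = 0 := by
          have hmid : sidePoint v w 0 ∈ segment ℝ v w := by
            rw [sidePoint_zero]
            exact ⟨1 / 2, 1 / 2, by norm_num, by norm_num, by norm_num, rfl⟩
          have h1 : ¬ (x = v ∧ y = w) := by
            rintro ⟨rfl, rfl⟩
            exact hm hmid
          have h2 : ¬ (x = w ∧ y = v) := by
            rintro ⟨rfl, rfl⟩
            exact hm (segment_symm ℝ y x ▸ hmid)
          rw [← ite_and, ← ite_and, if_neg h1, if_neg h2, sub_zero]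
        rw [hlim]
        have hcont := continuousAt_visualAngle hm
        have t1 : Tendsto (fun ε => visualAngle x y (sidePoint v w ε)) (𝓝[>] 0)
            (𝓝 (visualAngle x y (sidePoint v w 0))) :=
          (hcont.tendsto.comp ((continuous_sidePoint v w).tendsto 0)).mono_left nhdsWithin_le_nhds
        have hneg : Tendsto (fun ε => sidePoint v w (-ε)) (𝓝 0) (𝓝 (sidePoint v w 0)) := by
          have : Continuous fun ε => sidePoint v w (-ε) := by fun_prop
          simpa using this.tendsto 0
        have t2 : Tendsto (fun ε => visualAngle x y (sidePoint v w (-ε))) (𝓝[>] 0)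
            (𝓝 (visualAngle x y (sidePoint v w 0))) :=
          (hcont.tendsto.comp hneg).mono_left nhdsWithin_le_nhds
        simpa using (t1.const_mul (c x y)).sub (t2.const_mul (c x y))
    · have h1 : ∀ {r : ℝ}, (if x = v then if y = w then r else 0 else 0) = 0 := by
        intro r
        rw [← ite_and, if_neg]
        rintro ⟨rfl, rfl⟩
        exact hxy h
      have h2 : ∀ {r : ℝ}, (if x = w then if y = v then r else 0 else 0) = 0 := by
        intro r
        rw [← ite_and, if_neg]
        rintro ⟨rfl, rfl⟩
        exact hxy h.symm
      simp [hc x y hxy, h1, h2]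
  have := tendsto_finsetSum S fun x _ => tendsto_finsetSum S fun y _ => hterm x y
  simp only [Finset.sum_sub_distrib] at this
  simp only [winding]
  convert this using 2
  simp [hv, hw, mul_sub, Finset.sum_ite_irrel]

open Classical in
-- The points just left of the edge lie in the unique triangle on that side, or in the connected
-- complement, where the winding function has its value at `O`. At most one summand is nonzero.
theorem IsEdge.winding_sidePoint (hfin : K.faces.Finite) (hconn : IsConnected K.spaceᶜ)
    (hS : ∀ s ∈ K.faces, s ⊆ S)
    (hc : ∀ v w, ¬ K.IsEdge v w → c v w = 0)
    (hcyc : ∀ f : ℝ × ℝ → ℝ, ∑ v ∈ S, ∑ w ∈ S, c v w * (f w - f v) = 0)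
    {O : ℝ × ℝ} (hO : O ∈ K.spaceᶜ) {v w : ℝ × ℝ} (h : K.IsEdge v w) :
    ∀ᶠ ε in 𝓝[>] 0, winding S c (sidePoint v w ε) - winding S c O =
      ∑ u ∈ S, if K.IsTriangle v w u ∧ 0 < cross v w u then
        winding S c (centroid₃ v w u) - winding S c O else 0 := by
  by_cases hex : ∃ u, K.IsTriangle v w u ∧ 0 < cross v w u
  · obtain ⟨u, hu, hpos⟩ := hex
    filter_upwards [hu.sidePoint_eventually_mem_openTriangle hpos] with ε hε
    rw [Finset.sum_eq_single u, if_pos ⟨hu, hpos⟩, winding_eq_of_isPreconnected hc hcyc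
      (convex_openTriangle v w u).isPreconnected hu.openTriangle_subset_offEdges hε
      (centroid₃_mem hpos.ne')]
    · intro u' _ hne
      rw [if_neg]
      rintro ⟨hu', hpos'⟩
      exact hne (hu'.eq_of_same_side hu hpos' hpos)
    · intro hu'
      exact absurd (hS _ hu.2.2.2 (by simp)) hu'
  · push Not at hex
    filter_upwards [h.sidePoint_eventually_notMem_space hfin hex] with ε hε
    rw [winding_eq_of_isPreconnected hc hcyc hconn.isPreconnected compl_space_subset_offEdges hε hO,
      sub_self, Finset.sum_eq_zero]
    intro u _
    rw [if_neg]
    rintro ⟨h1, h2⟩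
    exact absurd h2 (not_lt.2 (hex u h1))

open Classical in
/-- Every 1-cycle of a planar complex without holes is a boundary. -/
theorem cycle_eq_boundary (hfin : K.faces.Finite) (hconn : IsConnected K.spaceᶜ)
    (hS : ∀ s ∈ K.faces, s ⊆ S)
    (hc : ∀ v w, ¬ K.IsEdge v w → c v w = 0)
    (hcyc : ∀ f : ℝ × ℝ → ℝ, ∑ v ∈ S, ∑ w ∈ S, c v w * (f w - f v) = 0)
    {O : ℝ × ℝ} (hO : O ∈ K.spaceᶜ) (v w : ℝ × ℝ) :
    2 * Real.pi * (c v w - c w v) = ∑ u ∈ S, if K.IsTriangle v w u then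
      SignType.sign (cross v w u) * (winding S c (centroid₃ v w u) - winding S c O) else 0 := by
  by_cases h : K.IsEdge v w
  · have hv : v ∈ S := hS _ h.2 (by simp)
    have hw : w ∈ S := hS _ h.2 (by simp)
    -- The jump is computed twice: from the chain `c`, and from the regions on the two sides of the
    -- edge.
    refine tendsto_nhds_unique (h.tendsto_winding_jump hc hv hw) ?_
    refine Tendsto.congr' ?_ tendsto_const_nhds
    filter_upwards [h.winding_sidePoint hfin hconn hS hc hcyc hO,
      h.symm.winding_sidePoint hfin hconn hS hc hcyc hO] with ε h1 h2
    rw [← sub_sub_sub_cancel_right _ _ (winding S c O), ← sidePoint_swap, h1, h2,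
      ← Finset.sum_sub_distrib]
    refine Finset.sum_congr rfl fun u _ => ?_
    by_cases hu : K.IsTriangle v w u
    · have hcen : centroid₃ w v u = centroid₃ v w u := by
        simp only [centroid₃, add_comm w.1, add_comm w.2]
      rw [cross_swap v w, hcen]
      rcases hu.cross_ne_zero.lt_or_gt with hlt | hgt
      · simp [hu, hu.swap, hlt, hlt.not_gt, sign_neg hlt]
      · simp [hu, hgt, hgt.not_gt, sign_pos hgt]
    · have hu' : ¬ K.IsTriangle w v u := fun h' => hu h'.swap
      simp [hu, hu']
  · rw [hc v w h, hc w v fun h' => h h'.symm, sub_self, mul_zero, eq_comm]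
    refine Finset.sum_eq_zero fun u _ => ?_
    rw [if_neg]
    exact fun hu => h hu.isEdge

/-- A closed 1-cochain vanishes on the cycles of a planar complex without holes. -/
theorem sum_cycle_smul_eq_zero (hfin : K.faces.Finite) (hconn : IsConnected K.spaceᶜ)
    (hS : ∀ s ∈ K.faces, s ⊆ S)
    (hc : ∀ v w, ¬ K.IsEdge v w → c v w = 0)
    (hcyc : ∀ f : ℝ × ℝ → ℝ, ∑ v ∈ S, ∑ w ∈ S, c v w * (f w - f v) = 0)
    {W : Type*} [AddCommGroup W] [Module ℝ W] {ω : ℝ × ℝ → ℝ × ℝ → W}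
    (hanti : ∀ v w, K.IsEdge v w → ω w v = -ω v w)
    (hclosed : ∀ u v w, K.IsTriangle u v w → ω u v + ω v w + ω w u = 0) :
    ∑ v ∈ S, ∑ w ∈ S, c v w • ω v w = 0 := by
  classical
  obtain ⟨O, hO⟩ := hconn.nonempty
  -- The 2-chain of normalized winding numbers, signed by orientation; it is invariant under cyclic
  -- rotation of the vertices.
  let g : ℝ × ℝ → ℝ × ℝ → ℝ × ℝ → ℝ := fun v w u => if K.IsTriangle v w u then
    SignType.sign (cross v w u) * (winding S c (centroid₃ v w u) - winding S c O) else 0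
  have hg : ∀ v w u, g w u v = g v w u := by
    intro v w u
    have hcen : centroid₃ w u v = centroid₃ v w u := by
      apply Prod.ext <;> simp only [centroid₃] <;> ring
    have hiff : K.IsTriangle w u v ↔ K.IsTriangle v w u :=
      ⟨fun h => h.rotate.rotate, fun h => h.rotate⟩
    simp only [g, hiff, cross_rotate, hcen]
  have h1 : (2 : ℝ) • ∑ v ∈ S, ∑ w ∈ S, c v w • ω v w =
      ∑ v ∈ S, ∑ w ∈ S, (c v w - c w v) • ω v w := by
    have hsw : ∑ v ∈ S, ∑ w ∈ S, c v w • ω v w = ∑ v ∈ S, ∑ w ∈ S, -(c w v • ω v w) := by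
      rw [Finset.sum_comm]
      refine Finset.sum_congr rfl fun v _ => Finset.sum_congr rfl fun w _ => ?_
      by_cases h : K.IsEdge v w
      · rw [hanti v w h, smul_neg]
      · simp [hc w v fun h' => h h'.symm]
    rw [two_smul]
    nth_rewrite 2 [hsw]
    simp only [← Finset.sum_add_distrib, sub_smul]
    simp only [sub_eq_add_neg]
  have h2 : (2 * Real.pi) • ∑ v ∈ S, ∑ w ∈ S, (c v w - c w v) • ω v w =
      ∑ v ∈ S, ∑ w ∈ S, ∑ u ∈ S, g v w u • ω v w := by
    simp only [Finset.smul_sum, smul_smul, ← Finset.sum_smul]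
    refine Finset.sum_congr rfl fun v _ => Finset.sum_congr rfl fun w _ => ?_
    rw [cycle_eq_boundary hfin hconn hS hc hcyc hO v w]
  have hrot : ∀ F : ℝ × ℝ → ℝ × ℝ → ℝ × ℝ → W,
      ∑ v ∈ S, ∑ w ∈ S, ∑ u ∈ S, F v w u = ∑ v ∈ S, ∑ w ∈ S, ∑ u ∈ S, F w u v := by
    intro F
    rw [Finset.sum_congr rfl fun v _ => Finset.sum_comm, Finset.sum_comm]
  -- Averaging over the three rotations collects the sum of `ω` around each triangle, which
  -- vanishes.
  have h3 : (3 : ℝ) • ∑ v ∈ S, ∑ w ∈ S, ∑ u ∈ S, g v w u • ω v w = 0 := by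
    have e1 := hrot fun v w u => g v w u • ω v w
    have e2 := hrot fun v w u => g w u v • ω w u
    simp only [hg] at e1 e2
    have : (3 : ℝ) = 1 + 1 + 1 := by norm_num
    rw [this, add_smul, add_smul, one_smul]
    nth_rewrite 3 [e1]
    rw [e2]
    nth_rewrite 2 [e1]
    simp only [← Finset.sum_add_distrib, ← smul_add]
    refine Finset.sum_eq_zero fun v _ => Finset.sum_eq_zero fun w _ =>
      Finset.sum_eq_zero fun u _ => ?_
    by_cases h : K.IsTriangle v w u
    · rw [hclosed v w u h, smul_zero]
    · simp [g, h]
  rw [← h2, ← h1] at h3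
  simpa [Real.pi_ne_zero] using h3

theorem sum_isEdge {A : Type*} [AddCommMonoid A] [Fintype {e : S × S // K.IsEdge e.1 e.2}]
    (F : ℝ × ℝ → ℝ × ℝ → A) (hF : ∀ v w, ¬ K.IsEdge v w → F v w = 0) :
    ∑ v ∈ S, ∑ w ∈ S, F v w = ∑ e : {e : S × S // K.IsEdge e.1 e.2}, F e.1.1 e.1.2 := by
  classical
  rw [← Finset.sum_coe_sort S fun v => ∑ w ∈ S, F v w]
  simp only [← Finset.sum_coe_sort S (F _)]
  rw [← Fintype.sum_prod_type' (f := fun v w : S => F v w),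
    ← Finset.sum_filter_of_ne (p := fun e : S × S => K.IsEdge e.1 e.2) fun e _ he => by
      by_contra h
      exact he (hF _ _ h)]
  exact Finset.sum_subtype _ (by simp) _

/-- Closed 1-cochains on a planar complex without holes are exact. -/
theorem exists_vertex_potential (hfin : K.faces.Finite) (hconn : IsConnected K.spaceᶜ)
    {W : Type*} [AddCommGroup W] [Module ℝ W] (ω : ℝ × ℝ → ℝ × ℝ → W)
    (hanti : ∀ v w, K.IsEdge v w → ω w v = -ω v w)
    (hclosed : ∀ u v w, K.IsTriangle u v w → ω u v + ω v w + ω w u = 0) :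
    ∃ r : ℝ × ℝ → W, ∀ v w, K.IsEdge v w → r w - r v = ω v w := by
  classical
  let S : Finset (ℝ × ℝ) := hfin.toFinset.biUnion id
  have hS : ∀ s ∈ K.faces, s ⊆ S := fun s hs =>
    Finset.subset_biUnion_of_mem id (hfin.mem_toFinset.2 hs)
  let E := {e : S × S // K.IsEdge e.1 e.2}
  obtain ⟨p, hp⟩ := exists_potential (k := ℝ) (fun e : E => e.1.1) (fun e : E => e.1.2)
    (fun e => ω e.1.1 e.1.2) fun c₀ hc₀ => by
      let c : ℝ × ℝ → ℝ × ℝ → ℝ := fun v w =>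
        if h : v ∈ S ∧ w ∈ S ∧ K.IsEdge v w then c₀ ⟨(⟨v, h.1⟩, ⟨w, h.2.1⟩), h.2.2⟩ else 0
      have hcE : ∀ e : E, c e.1.1 e.1.2 = c₀ e := fun e =>
        dif_pos ⟨e.1.1.2, e.1.2.2, e.2⟩
      have hc : ∀ v w, ¬ K.IsEdge v w → c v w = 0 := fun v w h => dif_neg fun h' => h h'.2.2
      have hcyc : ∀ f : ℝ × ℝ → ℝ, ∑ v ∈ S, ∑ w ∈ S, c v w * (f w - f v) = 0 := fun f => by
        rw [sum_isEdge (K := K) _ fun v w h => by rw [hc v w h, zero_mul]]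
        simpa only [hcE] using hc₀ fun v => f v
      have := sum_cycle_smul_eq_zero hfin hconn hS hc hcyc hanti hclosed
      rw [sum_isEdge (K := K) _ fun v w h => by rw [hc v w h, zero_smul]] at this
      simpa only [hcE] using this
  refine ⟨fun v => if hv : v ∈ S then p ⟨v, hv⟩ else 0, fun v w h => ?_⟩
  have hv : v ∈ S := hS _ h.2 (by simp)
  have hw : w ∈ S := hS _ h.2 (by simp)
  simpa [hv, hw] using hp ⟨(⟨v, hv⟩, ⟨w, hw⟩), h⟩

end Geometry.SimplicialComplex

end

/-! ### Dual graphs of planar triangulations -/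

namespace PlanarTriangulation

variable {Δ : PlanarTriangulation} {G : DirGraph Δ.Triangle Δ.dualGraph.edgeSet}

theorem IsDirectedDual.exists_edge (hG : Δ.IsDirectedDual G) {t t' : Δ.Triangle}
    (h : Δ.dualGraph.Adj t t') :
    ∃ e, (G.tail e = t ∧ G.head e = t') ∨ (G.tail e = t' ∧ G.head e = t) :=
  ⟨⟨s(t, t'), h⟩, by simpa using hG ⟨s(t, t'), h⟩⟩

theorem IsDirectedDual.isConnected (hG : Δ.IsDirectedDual G) : G.IsConnected := by
  refine ⟨?_, fun t t' => ?_⟩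
  · obtain ⟨s, hs⟩ := Δ.nonempty
    obtain ⟨t, ht, -, hcard⟩ := Δ.pure s hs
    exact ⟨⟨t, ht, hcard⟩⟩
  · induction Δ.edge_connected t t' with
    | refl => exact .refl _
    | @tail b d _ h ih =>
      refine .trans _ _ _ ih ?_
      by_cases hbd : b = d
      · rw [hbd]
        exact .refl _
      · obtain ⟨e, he | he⟩ := hG.exists_edge ⟨hbd, h⟩
        · exact .rel _ _ ⟨e, he⟩
        · exact .symm _ _ (.rel _ _ ⟨e, he⟩)

theorem IsDirectedDual.exists_common_vertex (hG : Δ.IsDirectedDual G) (e) :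
    ∃ P, P ∈ (G.tail e).1 ∧ P ∈ (G.head e).1 := by
  have h : Δ.dualGraph.Adj (G.tail e) (G.head e) := by
    rw [← SimpleGraph.mem_edgeSet, hG e]
    exact e.2
  obtain ⟨-, s, hs, -, h1, h2⟩ := h
  obtain ⟨P, hP⟩ := Geometry.SimplicialComplex.nonempty_of_mem_faces hs
  exact ⟨P, h1 hP, h2 hP⟩

variable {𝕜 : Type*} [RCLike 𝕜] {a b c : Δ.dualGraph.edgeSet → 𝕜}

/-- Supplies the lifting property of `topPart_bijective`: the translates of `q` to the individual
vertices are corrected by a potential so that they fit together. -/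
theorem exists_lift (hG : Δ.IsDirectedDual G)
    (hline : ∀ e, ∀ P : ℝ × ℝ, P ∈ (G.tail e).1 → P ∈ (G.head e).1 →
      a e * (P.1 : 𝕜) + b e * (P.2 : 𝕜) + c e = 0) (z : Δ.dualGraph.edgeSet → 𝕜)
    (q : Δ.Triangle → MvPolynomial (Fin 2) 𝕜)
    (hq : ∀ e, q (G.head e) - q (G.tail e) = C (z e) * affineSq (a e) (b e) 0) :
    ∃ p : Δ.Triangle → MvPolynomial (Fin 2) 𝕜,
      ∀ e, p (G.head e) - p (G.tail e) = C (z e) * affineSq (a e) (b e) (c e) := by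
  classical
  let T : ℝ × ℝ → MvPolynomial (Fin 2) 𝕜 →ₐ[𝕜] MvPolynomial (Fin 2) 𝕜 :=
    fun v => polyTranslate (v.1 : 𝕜) (v.2 : 𝕜)
  have hT : ∀ e, ∀ P : ℝ × ℝ, P ∈ (G.tail e).1 → P ∈ (G.head e).1 →
      T P (q (G.head e)) - T P (q (G.tail e)) = C (z e) * affineSq (a e) (b e) (c e) := by
    intro e P h1 h2
    rw [← map_sub, hq, map_mul, polyTranslate_affineSq (hline e P h1 h2), algHom_C, algebraMap_eq]
  -- Across an edge shared by two triangles, `T v` and `T w` turn the difference of the values of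
  -- `q` into the same multiple of the affine label.
  have hindep : ∀ (t t' : Δ.Triangle) (v w : ℝ × ℝ), v ≠ w → v ∈ t.1 → w ∈ t.1 → v ∈ t'.1 →
      w ∈ t'.1 → T w (q t) - T v (q t) = T w (q t') - T v (q t') := by
    intro t t' v w hvw hv hw hv' hw'
    by_cases htt : t = t'
    · rw [htt]
    have hadj : Δ.dualGraph.Adj t t' := by
      refine ⟨htt, {v, w}, (Geometry.SimplicialComplex.isEdge_of_mem t.2.1 hv hw hvw).2,
        Finset.card_pair hvw, ?_, ?_⟩
      · simp [Finset.insert_subset_iff, hv, hw]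
      · simp [Finset.insert_subset_iff, hv', hw']
    obtain ⟨e, ⟨rfl, rfl⟩ | ⟨rfl, rfl⟩⟩ := hG.exists_edge hadj
    · linear_combination hT e v hv hv' - hT e w hw hw'
    · linear_combination hT e w hw' hw - hT e v hv' hv
  let ω : ℝ × ℝ → ℝ × ℝ → MvPolynomial (Fin 2) 𝕜 := fun v w =>
    if h : ∃ t : Δ.Triangle, v ∈ t.1 ∧ w ∈ t.1 then T w (q h.choose) - T v (q h.choose) else 0
  have hω : ∀ (t : Δ.Triangle) (v w : ℝ × ℝ), v ≠ w → v ∈ t.1 → w ∈ t.1 →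
      ω v w = T w (q t) - T v (q t) := by
    intro t v w hvw hv hw
    have h : ∃ t : Δ.Triangle, v ∈ t.1 ∧ w ∈ t.1 := ⟨t, hv, hw⟩
    simp only [ω, dif_pos h]
    exact hindep _ _ _ _ hvw h.choose_spec.1 h.choose_spec.2 hv hw
  have hface : ∀ s ∈ Δ.complex.faces, ∃ t : Δ.Triangle, s ⊆ t.1 := fun s hs => by
    obtain ⟨t, ht, hst, hcard⟩ := Δ.pure s hs
    exact ⟨⟨t, ht, hcard⟩, hst⟩
  obtain ⟨r, hr⟩ := Geometry.SimplicialComplex.exists_vertex_potential Δ.finite Δ.no_holes ω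
    (fun v w h => by
      obtain ⟨t, ht⟩ := hface _ h.2
      rw [hω t v w h.1 (ht (by simp)) (ht (by simp)),
        hω t w v h.1.symm (ht (by simp)) (ht (by simp)), neg_sub])
    (fun u v w h => by
      obtain ⟨t, ht⟩ := hface _ h.2.2.2
      rw [hω t u v h.1 (ht (by simp)) (ht (by simp)), hω t v w h.2.1 (ht (by simp)) (ht (by simp)),
        hω t w u h.2.2.1 (ht (by simp)) (ht (by simp))]
      abel)
  have hne : ∀ t : Δ.Triangle, ∃ v, v ∈ t.1 := fun t =>
    Geometry.SimplicialComplex.nonempty_of_mem_faces t.2.1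
  choose x hx using hne
  -- Subtracting `r` removes the dependence on the vertex chosen in `t`, so any vertex common to two
  -- adjacent triangles can be used for both.
  have hp : ∀ (t : Δ.Triangle) (v : ℝ × ℝ), v ∈ t.1 →
      T (x t) (q t) - r (x t) = T v (q t) - r v := by
    intro t v hv
    by_cases h : x t = v
    · rw [h]
    · have h1 := hr (x t) v (Geometry.SimplicialComplex.isEdge_of_mem t.2.1 (hx t) hv h)
      rw [hω t _ _ h (hx t) hv] at h1
      linear_combination h1
  refine ⟨fun t => T (x t) (q t) - r (x t), fun e => ?_⟩
  obtain ⟨P, h1, h2⟩ := hG.exists_common_vertex e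
  simp only [hp _ P h1, hp _ P h2, sub_sub_sub_cancel_right]
  exact hT e P h1 h2

end PlanarTriangulation

theorem mainTheorem4 (𝕜 : Type*) [RCLike 𝕜] :
    -- face-translatable labelings `(a x + b y + c)²` of directed plane graphs
    (∀ (V E : Type*) [Fintype V] [Fintype E] (G : PlaneGraph V E) (a b c : E → 𝕜)
      (l' l : E → MvPolynomial (Fin 2) 𝕜),
      (∀ e, a e ≠ 0 ∨ b e ≠ 0) →
      (∀ e, l' e = affineSq (a e) (b e) (c e)) →
      (∀ e, l e = affineSq (a e) (b e) 0) →
      G.FaceTranslatable l' →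
      -- the cofactor map of `l'` maps onto the kernel of the extended cycle basis matrix
      (G.cofactor l' '' (G.splLE l' 2 : Set (V → MvPolynomial (Fin 2) 𝕜)) =
        {f | ∃ z : E → 𝕜, (G.extMatrix a b).mulVec z = 0 ∧ ∀ e, f e = MvPolynomial.C (z e)}) ∧
      -- the two spaces of splines are isomorphic through the cofactors
      (∀ v₀ : V,
        (∃ Ψ : G.splLEAt l' 2 v₀ ≃ₗ[𝕜] G.splHomAt l 2 v₀,
          ∀ p, G.cofactor l (Ψ p).1 = G.cofactor l' p.1) ∧
        G.splLEAt l 2 v₀ = G.splHomAt l 2 v₀) ∧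
      Nonempty (G.splLE l' 2 ≃ₗ[𝕜] G.splLE l 2) ∧
      -- an invertible change of variables brings all labels to the form `(x + m y + s)²`
      (∃ (τ : MvPolynomial (Fin 2) 𝕜 ≃ₐ[𝕜] MvPolynomial (Fin 2) 𝕜) (x₀ y₀ : 𝕜) (u m s : E → 𝕜),
        τ (MvPolynomial.X 0) =
          MvPolynomial.C x₀ * MvPolynomial.X 0 - MvPolynomial.C y₀ * MvPolynomial.X 1 ∧
        τ (MvPolynomial.X 1) =
          MvPolynomial.C y₀ * MvPolynomial.X 0 + MvPolynomial.C x₀ * MvPolynomial.X 1 ∧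
        (∀ e, u e ≠ 0) ∧
        (∀ e, τ (l' e) = MvPolynomial.C (u e) * affineSq 1 (m e) (s e)) ∧
        (∀ e, τ (l e) = MvPolynomial.C (u e) * affineSq 1 (m e) 0) ∧
        G.FaceTranslatable (fun e => affineSq 1 (m e) (s e)) ∧
        (∀ (d : ℕ) (p : V → MvPolynomial (Fin 2) 𝕜),
          (p ∈ G.splLE l' d ↔
            (fun v => τ (p v)) ∈ G.splLE (fun e => affineSq 1 (m e) (s e)) d) ∧
          (p ∈ G.splLE l d ↔
            (fun v => τ (p v)) ∈ G.splLE (fun e => affineSq 1 (m e) 0) d)))) ∧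
    -- dual graphs of planar triangulations, each edge labeled by the square of an equation of
    -- the line that carries the common edge of the two triangles
    (∀ (Δ : PlanarTriangulation) (G : DirGraph Δ.Triangle Δ.dualGraph.edgeSet)
      (a b c : Δ.dualGraph.edgeSet → 𝕜)
      (l' l : Δ.dualGraph.edgeSet → MvPolynomial (Fin 2) 𝕜),
      Δ.IsDirectedDual G →
      (∀ e, a e ≠ 0 ∨ b e ≠ 0) →
      (∀ e, ∀ P : ℝ × ℝ, P ∈ (G.tail e).1 → P ∈ (G.head e).1 →
        a e * (P.1 : 𝕜) + b e * (P.2 : 𝕜) + c e = 0) →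
      (∀ e, l' e = affineSq (a e) (b e) (c e)) →
      (∀ e, l e = affineSq (a e) (b e) 0) →
      (∀ v₀ : Δ.Triangle,
        (∃ Ψ : G.splLEAt l' 2 v₀ ≃ₗ[𝕜] G.splHomAt l 2 v₀,
          ∀ p, G.cofactor l (Ψ p).1 = G.cofactor l' p.1) ∧
        G.splLEAt l 2 v₀ = G.splHomAt l 2 v₀) ∧
      Nonempty (G.splLE l' 2 ≃ₗ[𝕜] G.splLE l 2)) := by
  refine ⟨?_, ?_⟩
  · intro V E _ _ G a b c l' l hab hl' hl hG
    obtain rfl : l' = fun e => affineSq (a e) (b e) (c e) := funext hl'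
    obtain rfl : l = fun e => affineSq (a e) (b e) 0 := funext hl
    obtain ⟨h₁, h₂⟩ := DirGraph.spline_spaces_equiv G.connected hab
      (hG.exists_lift G) hl' hl
    exact ⟨G.cofactor_image_splLE hab hG, h₁, h₂, G.exists_normal_form hab hG⟩
  · intro Δ G a b c l' l hG hab hline hl' hl
    exact DirGraph.spline_spaces_equiv hG.isConnected hab
      (PlanarTriangulation.exists_lift hG hline) hl' hl
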